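/- A motif $M$ is a finite simple graph, considered up to isomorphism, with $v(M)$ vertices, $e(M)$ edges and $\mathrm{aut}(M)$ automorphisms. Let $n\ge 1$ be an integer, $0<p\le \tfrac12$ and $0<\rho\le 1$. Let $\mathcal P_1$ be the law of the correlated Erdős–Rényi pair $(G_1,G_2)\sim\mathcal G(n,p,\rho)$ on the vertex set $[n]$: a latent bijection $\pi$ of $[n]$ is uniformly random and, given $\pi$, the pairs $(\mathbf 1\{uv\in E(G_1)\},\mathbf 1\{\pi(u)\pi(v)\in E(G_2)\})$ are independent over the unordered pairs $uv$, each with both marginals Bernoulli($p$) and correlation coefficient $\rho$. For a graph $G$ on $[n]$ and a motif $M$ put $$\mathrm{inj}(M,\bar G)=\sum_{\varphi:V(M)\to[n]\ \text{injective}}\ \prod_{uv\in E(M)}\bigl(\mathbf 1\{\varphi(u)\varphi(v)\in E(G)\}-p\bigr).$$ For a finite family $\mathcal M$ of pairwise non-isomorphic motifs let $$\mathcal T_{\mathcal M}=\sum_{M\in\mathcal M}\omega_M\,\mathrm{inj}(M,\bar G_1)\,\mathrm{inj}(M,\bar G_2),\qquad \omega_M=\frac{\rho^{e(M)}\,(n-v(M))!}{n!\,(p(1-p))^{e(M)}\,\mathrm{aut}(M)}$$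 (motifs with $v(M)>n$ contribute $0$). Let $C\in\mathbb R$ and $\epsilon_0>0$, and suppose that $\mathcal M$ is $C$-admissible with constant $\epsilon_0$, that is: (1) every $M\in\mathcal M$ is connected; (2) $\max(v(M),e(M))\le C$ for every $M\in\mathcal M$; (3) $\sum_{M\in\mathcal M}\rho^{2e(M)}\ge 400$; (4) $n^{v(M')}p^{e(M')}\ge n^{\epsilon_0}$ for every $M\in\mathcal M$ and every subgraph $M'\subseteq M$ with at least one vertex. If $\tau=\tfrac12\,\mathbb E_{\mathcal P_1}[\mathcal T_{\mathcal M}]$, then, with $\kappa=\exp\bigl(\tfrac{C^2}{n-2C+1}\bigr)$ (and $\kappa=1$ if $n-2C+1=0$), $$\mathcal P_1(\mathcal T_{\mathcal M}<\tau)\ \le\ 4\left(3\,n^{-\epsilon_0/2}(4C)^{8C}\rho^{-2C}+\frac{\kappa+1}{\sum_{M\in\mathcal M}\rho^{2e(M)}}+\kappa-1\right).$$ No growth condition on $C$ relative to $n$ is needed: the bound holds for every $n\ge1$, hence along every sequence of admissible families with $C=o\bigl(\log n/\max(\log\log n,-\log\rho)\bigr)$. -/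

import Mathlib

namespace MotifCount

open MeasureTheory
open scoped ENNReal

/-- A motif: a finite simple graph, given on the vertex set `Fin v`. -/
structure Motif where
  /-- the number of vertices `v(M)` -/
  v : ℕ
  /-- the graph itself -/
  graph : SimpleGraph (Fin v)

/-- The number of edges `e(M)`. -/
noncomputable def Motif.e (M : Motif) : ℕ := M.graph.edgeSet.ncard

/-- The number of automorphisms `aut(M)`. -/
noncomputable def Motif.aut (M : Motif) : ℕ := Nat.card (M.graph ≃g M.graph)

/-- Motifs are considered up to isomorphism: a (finite) motif family has at most one
representative of each isomorphism class. -/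
def IsMotifFamily (𝓜 : Finset Motif) : Prop :=
  ∀ M ∈ 𝓜, ∀ N ∈ 𝓜, Nonempty (M.graph ≃g N.graph) → M = N

/-- The signal score `∑_{M ∈ 𝓜} ρ^{2 e(M)}`. -/
noncomputable def signalScore (ρ : ℝ) (𝓜 : Finset Motif) : ℝ :=
  ∑ M ∈ 𝓜, ρ ^ (2 * M.e)

/-- `C`-admissibility at a given `n`, with exponent `ε₀`. No growth condition on `C` as `n → ∞`
is imposed, so that every admissible sequence of families satisfies this at each of its terms. -/
structure IsAdmissible (n : ℕ) (p ρ C ε₀ : ℝ) (𝓜 : Finset Motif) : Prop where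
  connected : ∀ M ∈ 𝓜, M.graph.Connected
  size_le : ∀ M ∈ 𝓜, max (M.v : ℝ) (M.e : ℝ) ≤ C
  signal : 400 ≤ signalScore ρ 𝓜
  eps_pos : 0 < ε₀
  subgraph : ∀ M ∈ 𝓜, ∀ M' : M.graph.Subgraph, M'.verts.Nonempty →
    (n : ℝ) ^ ε₀ ≤ (n : ℝ) ^ M'.verts.ncard * p ^ M'.edgeSet.ncard

/-- The weight of the motif `M` in a weighted graph on `V` with edge weights `β`, along the map
`f : V(M) → V`, that is, `hom_f(M, β) = ∏_{uv ∈ E(M)} β_{f(u)f(v)}`. -/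
noncomputable def homWeight {V : Type*} (M : Motif) (β : Sym2 V → ℝ) (f : Fin M.v → V) : ℝ :=
  ∏ e ∈ M.graph.edgeSet.toFinite.toFinset, β (e.map f)

/-- `inj(M, β)`: the sum of `hom_f(M, β)` over all injective `f : V(M) → V`. -/
noncomputable def injCount {V : Type*} [Fintype V] [DecidableEq V] (M : Motif)
    (β : Sym2 V → ℝ) : ℝ :=
  ∑ f : Fin M.v ↪ V, homWeight M β f

open Classical in
/-- The centred edge weights `1{uv ∈ E(G)} - p`. -/
noncomputable def centered {V : Type*} (p : ℝ) (G : SimpleGraph V) (e : Sym2 V) : ℝ :=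
  (if e ∈ G.edgeSet then 1 else 0) - p

/-- The weight `ω_M = ρ^{e(M)} (n - v(M))! / (n! (p(1-p))^{e(M)} aut(M))`. If `v(M) > n` then
its value is irrelevant, since there are no injections from `V(M)`. -/
noncomputable def weight (n : ℕ) (p ρ : ℝ) (M : Motif) : ℝ :=
  ρ ^ M.e * (Nat.factorial (n - M.v) : ℝ) / ((Nat.factorial n : ℝ) * (p * (1 - p)) ^ M.e * (M.aut : ℝ))

/-- The motif counting statistic
`T_𝓜(G₁, G₂) = ∑_{M ∈ 𝓜} ω_M inj(M, Ḡ₁) inj(M, Ḡ₂)`. -/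
noncomputable def statistic (n : ℕ) (p ρ : ℝ) (𝓜 : Finset Motif)
    (G : SimpleGraph (Fin n) × SimpleGraph (Fin n)) : ℝ :=
  ∑ M ∈ 𝓜, weight n p ρ M * injCount M (centered p G.1) * injCount M (centered p G.2)

/-- The law on `{0,1}²` with both marginals Bernoulli(`p`) and correlation coefficient `ρ`. -/
noncomputable def corrBernoulli (p ρ : ℝ) : Measure (Bool × Bool) :=
  ENNReal.ofReal (p ^ 2 + ρ * (p * (1 - p))) • Measure.dirac (true, true)
    + ENNReal.ofReal ((1 - ρ) * (p * (1 - p))) • Measure.dirac (true, false)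
    + ENNReal.ofReal ((1 - ρ) * (p * (1 - p))) • Measure.dirac (false, true)
    + ENNReal.ofReal ((1 - p) ^ 2 + ρ * (p * (1 - p))) • Measure.dirac (false, false)

/-- The pair of graphs determined by a bijection `π` and a pair of bits `x e` for each vertex pair
`e`: the edge `uv` is in `G₁` iff the first bit of `x (uv)` is set, and `π(u)π(v)` is in `G₂`
iff the second bit of `x (uv)` is set. Loops are discarded. -/
def graphPair {n : ℕ} (π : Equiv.Perm (Fin n)) (x : Sym2 (Fin n) → Bool × Bool) :
    SimpleGraph (Fin n) × SimpleGraph (Fin n) :=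
  (SimpleGraph.fromEdgeSet {e | (x e).1 = true},
   SimpleGraph.fromEdgeSet {e | (x (e.map π.symm)).2 = true})

/-- The correlated Erdős–Rényi law conditionally on the latent bijection `π`: the pairs of
indicators of `uv ∈ E(G₁)`, `π(u)π(v) ∈ E(G₂)` are independent over the vertex pairs `uv`, each
with law `corrBernoulli p ρ`. -/
noncomputable def corrERGiven (n : ℕ) (p ρ : ℝ) (π : Equiv.Perm (Fin n)) :
    Measure (SimpleGraph (Fin n) × SimpleGraph (Fin n)) :=
  (Measure.pi fun _ : Sym2 (Fin n) => corrBernoulli p ρ).map (graphPair π)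

/-- The law of the correlated Erdős–Rényi graphs `𝒢(n, p, ρ)`: the latent bijection is uniform. -/
noncomputable def corrER (n : ℕ) (p ρ : ℝ) :
    Measure (SimpleGraph (Fin n) × SimpleGraph (Fin n)) :=
  (Nat.factorial n : ℝ≥0∞)⁻¹ • ∑ π : Equiv.Perm (Fin n), corrERGiven n p ρ π

end MotifCount

/-!
The proof is Chebyshev's inequality for `𝒯`, whose mean is at least `S = ∑_{M ∈ 𝓜} ρ^{2 e(M)}` and
whose variance is at most `2 S + L S²` with `L = n^{-ε₀ / 2} (4 C)^{8 C} ρ^{-2 C}`, at least when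
`n ≥ 2 C`; for smaller `n` we have `L ≥ 2` and the bound is trivial.

Injective homomorphism counts do not see the labels, so the latent bijection may be taken to be the
identity. Then `𝔼[𝒯²]` is a sum over quadruples of copies, two of `M` and two of `N`, one of each in
either graph, and a quadruple contributes only if each of its edges lies in at least two copies. If
no vertex lies in three copies, then the copies coincide in pairs, because a coincidence of two
copies at one edge spreads along the connected motif. The pairing within `M` and within `N`
reproduces the product of the means, and the other two pairings only occur for `M = N`, where they
give `2 S`.

If some vertex lies in three copies, let `A` be what the two copies in the first graph share with
the copies in the second one, and `B` the reverse. As everything is covered twice, half of the total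
number of edges (or vertices) is their number in the union plus half of their numbers in `A` and
`B`. At least one of `A` and `B` is nonempty, so by condition (4) the product of their factors
`n^v p^e` is at least `n^{ε₀}`, and its square root is what such quadruples lose.
-/

namespace MotifCount

open MeasureTheory ProbabilityTheory
open scoped ENNReal

/-! ### Edge sets covered twice -/

section Pairing

variable {ι α V : Type*}

/-- Every element of a member of the family `S` lies in another member as well. -/
def CoveredTwice (S : ι → Finset α) : Prop := ∀ i, ∀ x ∈ S i, ∃ j, j ≠ i ∧ x ∈ S j

/-- No element lies in three different members of the family `S`. -/
def NoTriplePoint (S : ι → Finset α) : Prop :=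
  ∀ ⦃i j k⦄, i ≠ j → i ≠ k → j ≠ k → ∀ ⦃x⦄, x ∈ S i → x ∈ S j → x ∉ S k

variable [DecidableEq V]

/-- The vertices covered by a set of edges. A graph without isolated vertices is recovered from its
edge set, so a copy of a connected motif with an edge is represented by its edge set alone. -/
def verts (E : Finset (Sym2 V)) : Finset V := E.biUnion Sym2.toFinset

lemma mem_verts {E : Finset (Sym2 V)} {u : V} : u ∈ verts E ↔ ∃ w, s(u, w) ∈ E := by
  simp only [verts, Finset.mem_biUnion, Sym2.mem_toFinset]
  exact ⟨fun ⟨_, he, w, hw⟩ => ⟨w, hw ▸ he⟩, fun ⟨w, hw⟩ => ⟨_, hw, Sym2.mem_mk_left u w⟩⟩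

lemma left_mem_verts {E : Finset (Sym2 V)} {u w : V} (h : s(u, w) ∈ E) : u ∈ verts E :=
  mem_verts.2 ⟨w, h⟩

lemma right_mem_verts {E : Finset (Sym2 V)} {u w : V} (h : s(u, w) ∈ E) : w ∈ verts E :=
  mem_verts.2 ⟨u, Sym2.eq_swap ▸ h⟩

lemma verts_biUnion (s : Finset ι) (E : ι → Finset (Sym2 V)) :
    verts (s.biUnion E) = s.biUnion fun i => verts (E i) :=
  Finset.biUnion_biUnion ..

lemma CoveredTwice.verts {E : ι → Finset (Sym2 V)} (h : CoveredTwice E) :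
    CoveredTwice fun i => verts (E i) := by
  intro i u hu
  obtain ⟨w, hw⟩ := mem_verts.1 hu
  obtain ⟨j, hj, hwj⟩ := h i _ hw
  exact ⟨j, hj, left_mem_verts hwj⟩

/-- A set of edges that forms a nonempty connected graph on the vertices it covers. -/
structure IsConnectedEdgeSet (E : Finset (Sym2 V)) : Prop where
  nonempty : E.Nonempty
  reachable : ∀ u ∈ verts E, ∀ w ∈ verts E,
    (SimpleGraph.fromEdgeSet (E : Set (Sym2 V))).Reachable u w

lemma IsConnectedEdgeSet.verts_subset_of_closed {E : Finset (Sym2 V)} (hE : IsConnectedEdgeSet E)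
    {S : Finset V} {u : V} (hu : u ∈ verts E) (huS : u ∈ S)
    (hS : ∀ a b, s(a, b) ∈ E → a ∈ S → b ∈ S) : verts E ⊆ S := by
  intro w hw
  obtain ⟨walk⟩ := hE.reachable u hu w hw
  clear hu hw
  induction walk with
  | nil => exact huS
  | cons hadj _ ih => exact ih (hS _ _ ((SimpleGraph.fromEdgeSet_adj _).1 hadj).1 huS)

variable {E : ι → Finset (Sym2 V)}

/-- At a vertex shared with `E j`, every edge of `E i` can only be covered by `E j`, so that `E j`
spreads along the connected set `E i`. -/
lemma exists_ne_subset (hconn : ∀ i, IsConnectedEdgeSet (E i)) (hcov : CoveredTwice E)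
    (hpt : NoTriplePoint fun i => verts (E i)) (i : ι) : ∃ j, j ≠ i ∧ E i ⊆ E j := by
  obtain ⟨e, he⟩ := (hconn i).nonempty
  obtain ⟨j, hj, hej⟩ := hcov i e he
  induction e with | _ u w =>
  have mem_of_vertex : ∀ a b, s(a, b) ∈ E i → a ∈ verts (E j) → s(a, b) ∈ E j := by
    intro a b hab ha
    obtain ⟨k, hk, habk⟩ := hcov i _ hab
    obtain rfl : j = k := by
      by_contra hjk
      exact hpt hj.symm hk.symm hjk (left_mem_verts hab) ha (left_mem_verts habk)
    exact habk
  have hverts : verts (E i) ⊆ verts (E j) :=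
    (hconn i).verts_subset_of_closed (left_mem_verts he) (left_mem_verts hej)
      fun a b hab ha => right_mem_verts (mem_of_vertex a b hab ha)
  refine ⟨j, hj, fun e he => ?_⟩
  induction e with | _ a b => exact mem_of_vertex a b he (hverts (left_mem_verts he))

lemma exists_ne_eq (hconn : ∀ i, IsConnectedEdgeSet (E i)) (hcov : CoveredTwice E)
    (hpt : NoTriplePoint fun i => verts (E i)) (i : ι) : ∃ j, j ≠ i ∧ E i = E j := by
  obtain ⟨j, hj, hij⟩ := exists_ne_subset hconn hcov hpt i
  obtain ⟨k, hk, hjk⟩ := exists_ne_subset hconn hcov hpt j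
  obtain ⟨e, he⟩ := (hconn i).nonempty
  induction e with | _ u w =>
  obtain rfl : i = k := by
    by_contra hik
    exact hpt hj.symm hik hk.symm (left_mem_verts he) (left_mem_verts (hij he))
      (left_mem_verts (hjk (hij he)))
  exact ⟨j, hj, hij.antisymm hjk⟩

lemma disjoint_of_eq (hpt : NoTriplePoint fun i => verts (E i)) {i j k : ι} (hij : i ≠ j)
    (hik : i ≠ k) (hjk : j ≠ k) (h : E i = E j) : Disjoint (E i) (E k) := by
  rw [Finset.disjoint_left]
  rintro ⟨u, w⟩ hi hk
  exact hpt hij hik hjk (left_mem_verts hi) (left_mem_verts (h ▸ hi)) (left_mem_verts hk)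

lemma eq_in_pairs_of_exists_ne_eq {x : Fin 4 → α} (h : ∀ i, ∃ j, j ≠ i ∧ x i = x j) :
    (x 0 = x 2 ∧ x 1 = x 3) ∨ (x 0 = x 3 ∧ x 1 = x 2) ∨ (x 0 = x 1 ∧ x 2 = x 3) := by
  simp only [Fin.forall_fin_succ, Fin.exists_fin_succ] at h
  grind

end Pairing

/-! ### Overlaps of four edge sets -/

section Overlap

variable {α V : Type*} [DecidableEq α] [DecidableEq V]

/-- The elements that `S 0` and `S 1` share with one of `S 2`, `S 3`. -/
def leftOverlap (S : Fin 4 → Finset α) : Finset α := S 0 ∩ S 1 ∩ (S 2 ∪ S 3)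

/-- The elements that `S 2` and `S 3` share with one of `S 0`, `S 1`. -/
def rightOverlap (S : Fin 4 → Finset α) : Finset α := S 2 ∩ S 3 ∩ (S 0 ∪ S 1)

/-- An element of exactly two, three or four of the sets lies in zero, one or two overlaps. -/
lemma sum_card_eq_of_coveredTwice {S : Fin 4 → Finset α} (hcov : CoveredTwice S) :
    ∑ i, (S i).card = 2 * (Finset.univ.biUnion S).card + (leftOverlap S).card
      + (rightOverlap S).card := by
  set U := Finset.univ.biUnion S with hU
  have hleft : leftOverlap S ⊆ U := fun x hx => by
    simp only [leftOverlap, Finset.mem_inter] at hx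
    exact Finset.mem_biUnion.2 ⟨0, Finset.mem_univ _, hx.1.1⟩
  have hright : rightOverlap S ⊆ U := fun x hx => by
    simp only [rightOverlap, Finset.mem_inter] at hx
    exact Finset.mem_biUnion.2 ⟨2, Finset.mem_univ _, hx.1.1⟩
  have hcard : ∀ s ⊆ U, s.card = ∑ x ∈ U, if x ∈ s then 1 else 0 := fun s hs => by
    rw [Finset.sum_boole, Finset.filter_mem_eq_inter, Finset.inter_eq_right.2 hs, Nat.cast_id]
  rw [hcard _ hleft, hcard _ hright, Finset.card_eq_sum_ones U, Finset.mul_sum,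
    Finset.sum_congr rfl fun i _ =>
      hcard (S i) (Finset.subset_biUnion_of_mem S (Finset.mem_univ i)),
    Finset.sum_comm, ← Finset.sum_add_distrib, ← Finset.sum_add_distrib]
  refine Finset.sum_congr rfl fun x hx => ?_
  have hcovx := fun i => hcov i x
  simp only [hU, Finset.mem_biUnion, Finset.mem_univ, true_and, Fin.exists_fin_succ] at hx
  simp only [Fin.forall_fin_succ, Fin.exists_fin_succ] at hcovx
  simp only [Fin.sum_univ_four, leftOverlap, rightOverlap, Finset.mem_inter, Finset.mem_union]
  grind

lemma overlap_nonempty_of_not_noTriplePoint {S : Fin 4 → Finset α} (h : ¬ NoTriplePoint S) :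
    (leftOverlap S).Nonempty ∨ (rightOverlap S).Nonempty := by
  simp only [NoTriplePoint, not_forall, not_not] at h
  obtain ⟨i, j, k, hij, hik, hjk, u, hi, hj, hk⟩ := h
  suffices u ∈ leftOverlap S ∨ u ∈ rightOverlap S from this.imp (fun h => ⟨u, h⟩) fun h => ⟨u, h⟩
  simp only [leftOverlap, rightOverlap, Finset.mem_inter, Finset.mem_union]
  fin_cases i <;> fin_cases j <;> fin_cases k <;> simp_all

lemma verts_leftOverlap_subset (E : Fin 4 → Finset (Sym2 V)) :
    verts (leftOverlap E) ⊆ leftOverlap fun i => verts (E i) := by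
  intro u hu
  obtain ⟨w, hw⟩ := mem_verts.1 hu
  simp only [leftOverlap, Finset.mem_inter, Finset.mem_union] at hw ⊢
  exact ⟨⟨left_mem_verts hw.1.1, left_mem_verts hw.1.2⟩, hw.2.imp left_mem_verts left_mem_verts⟩

lemma verts_rightOverlap_subset (E : Fin 4 → Finset (Sym2 V)) :
    verts (rightOverlap E) ⊆ rightOverlap fun i => verts (E i) := by
  intro u hu
  obtain ⟨w, hw⟩ := mem_verts.1 hu
  simp only [rightOverlap, Finset.mem_inter, Finset.mem_union] at hw ⊢
  exact ⟨⟨left_mem_verts hw.1.1, left_mem_verts hw.1.2⟩, hw.2.imp left_mem_verts left_mem_verts⟩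

/-- Every graph `(W, E')` contained in the graph with edge set `E` satisfies the density bound
`x ^ ε ≤ x ^ |W| * p ^ |E'|` of condition (4), where `x` stands for the number of vertices of the
ambient random graph. -/
def IsDense (x p ε : ℝ) (E : Finset (Sym2 V)) : Prop :=
  ∀ E' ⊆ E, ∀ W ⊆ verts E, W.Nonempty → verts E' ⊆ W → x ^ ε ≤ x ^ W.card * p ^ E'.card

variable {x p q ε : ℝ}

lemma IsDense.one_le {E E' : Finset (Sym2 V)} {W : Finset V} (hE : IsDense x p ε E) (hx : 1 ≤ x)
    (hε : 0 ≤ ε) (hE' : E' ⊆ E) (hW : W ⊆ verts E) (hE'W : verts E' ⊆ W) :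
    1 ≤ x ^ W.card * p ^ E'.card := by
  rcases W.eq_empty_or_nonempty with rfl | hne
  · obtain rfl : E' = ∅ := Finset.eq_empty_of_forall_notMem <| by
      rintro ⟨a, b⟩ hab
      exact Finset.notMem_empty a (hE'W (left_mem_verts hab))
    simp
  · exact (Real.one_le_rpow hx hε).trans (hE E' hE' W hW hne hE'W)

lemma rpow_le_overlap_mul_overlap {E : Fin 4 → Finset (Sym2 V)} (hx : 1 ≤ x) (hε : 0 ≤ ε)
    (hdense : ∀ i, IsDense x p ε (E i)) (htriple : ¬ NoTriplePoint fun i => verts (E i)) :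
    x ^ ε ≤ (x ^ (leftOverlap fun i => verts (E i)).card * p ^ (leftOverlap E).card) *
      (x ^ (rightOverlap fun i => verts (E i)).card * p ^ (rightOverlap E).card) := by
  have inter_subset {β : Type _} [DecidableEq β] (A B C : Finset β) : A ∩ B ∩ C ⊆ A :=
    Finset.inter_subset_left.trans Finset.inter_subset_left
  have hx0 : 0 ≤ x ^ ε := Real.rpow_nonneg (zero_le_one.trans hx) ε
  have hleft := (hdense 0).one_le hx hε (inter_subset ..) (inter_subset ..)
    (verts_leftOverlap_subset E)
  have hright := (hdense 2).one_le hx hε (inter_subset ..) (inter_subset ..)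
    (verts_rightOverlap_subset E)
  rcases overlap_nonempty_of_not_noTriplePoint htriple with h | h
  · have := hdense 0 _ (inter_subset ..) _ (inter_subset ..) h (verts_leftOverlap_subset E)
    exact this.trans (le_mul_of_one_le_right (hx0.trans this) hright)
  · have := hdense 2 _ (inter_subset ..) _ (inter_subset ..) h (verts_rightOverlap_subset E)
    exact this.trans (le_mul_of_one_le_left (hx0.trans this) hleft)

lemma sq_pow_card_biUnion_mul_rpow_le {E : Fin 4 → Finset (Sym2 V)} (hx : 1 ≤ x)
    (hε : 0 ≤ ε) (hcov : CoveredTwice E) (hdense : ∀ i, IsDense x p ε (E i))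
    (htriple : ¬ NoTriplePoint fun i => verts (E i)) :
    (x ^ (verts (Finset.univ.biUnion E)).card * p ^ (Finset.univ.biUnion E).card) ^ 2 * x ^ ε
      ≤ x ^ (∑ i, (verts (E i)).card) * p ^ (∑ i, (E i).card) := by
  have : 0 ≤ x := zero_le_one.trans hx
  rw [sum_card_eq_of_coveredTwice hcov, sum_card_eq_of_coveredTwice hcov.verts, verts_biUnion]
  calc _ ≤ (x ^ (Finset.univ.biUnion fun i => verts (E i)).card
        * p ^ (Finset.univ.biUnion E).card) ^ 2
        * ((x ^ (leftOverlap fun i => verts (E i)).card * p ^ (leftOverlap E).card) *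
      (x ^ (rightOverlap fun i => verts (E i)).card * p ^ (rightOverlap E).card)) := by
        gcongr
        exact rpow_le_overlap_mul_overlap hx hε hdense htriple
    _ = _ := by ring

lemma pow_le_of_sq_mul_rpow_le (hx : 0 < x) (hp : 0 < p) (hpq : p ≤ 2 * q) {u v m k : ℕ}
    (hmk : m ≤ k) (h : (x ^ u * p ^ m) ^ 2 * x ^ ε ≤ (x ^ v * p ^ k) ^ 2) :
    q ^ m ≤ 2 ^ k * x ^ (-ε / 2) * x ^ v * q ^ k * x⁻¹ ^ u := by
  have hq : 0 ≤ q := by linarith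
  obtain ⟨d, rfl⟩ := Nat.exists_eq_add_of_le hmk
  have hsqrt : (x ^ (ε / 2)) ^ 2 = x ^ ε := by
    rw [← Real.rpow_mul_natCast hx.le]
    norm_num
  have hroot : x ^ u * p ^ m * x ^ (ε / 2) ≤ x ^ v * p ^ (m + d) := by
    refine le_of_sq_le_sq ?_ (by positivity)
    rwa [mul_pow, hsqrt]
  have hgain : x ^ u * x ^ (ε / 2) ≤ x ^ v * (2 ^ (m + d) * q ^ d) := by
    refine le_of_mul_le_mul_left ?_ (pow_pos hp m)
    calc p ^ m * (x ^ u * x ^ (ε / 2)) = x ^ u * p ^ m * x ^ (ε / 2) := by ring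
      _ ≤ x ^ v * p ^ (m + d) := hroot
      _ = p ^ m * (x ^ v * p ^ d) := by ring
      _ ≤ p ^ m * (x ^ v * (2 * q) ^ d) := by gcongr
      _ = p ^ m * (x ^ v * (2 ^ d * q ^ d)) := by ring
      _ ≤ p ^ m * (x ^ v * (2 ^ (m + d) * q ^ d)) := by
          gcongr
          · norm_num
          · omega
  have hcancel : x ^ (ε / 2) * x ^ (-ε / 2) = 1 := by
    rw [← Real.rpow_add hx, neg_div, add_neg_cancel, Real.rpow_zero]
  calc q ^ m = q ^ m * (x ^ u * x⁻¹ ^ u) * (x ^ (ε / 2) * x ^ (-ε / 2)) := by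
        rw [← mul_pow, mul_inv_cancel₀ hx.ne', one_pow, hcancel, mul_one, mul_one]
    _ = q ^ m * x⁻¹ ^ u * x ^ (-ε / 2) * (x ^ u * x ^ (ε / 2)) := by ring
    _ ≤ q ^ m * x⁻¹ ^ u * x ^ (-ε / 2) * (x ^ v * (2 ^ (m + d) * q ^ d)) := by gcongr
    _ = _ := by ring

/-- A common vertex of three of the sets gains the factor `x ^ (-ε / 2)`. -/
lemma pow_card_biUnion_le {E : Fin 4 → Finset (Sym2 V)} (hx : 1 ≤ x) (hp : 0 < p)
    (hpq : p ≤ 2 * q) (hε : 0 ≤ ε) (hcov : CoveredTwice E) (hdense : ∀ i, IsDense x p ε (E i))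
    (htriple : ¬ NoTriplePoint fun i => verts (E i)) {v k : ℕ}
    (hv : ∑ i, (verts (E i)).card = 2 * v) (hk : ∑ i, (E i).card = 2 * k) :
    q ^ (Finset.univ.biUnion E).card
      ≤ 2 ^ k * x ^ (-ε / 2) * x ^ v * q ^ k * x⁻¹ ^ (verts (Finset.univ.biUnion E)).card := by
  have hmk : (Finset.univ.biUnion E).card ≤ k := by
    have := sum_card_eq_of_coveredTwice hcov
    omega
  have hsq := sq_pow_card_biUnion_mul_rpow_le hx hε hcov hdense htriple
  rw [hv, hk] at hsq
  exact pow_le_of_sq_mul_rpow_le (zero_lt_one.trans_le hx) hp hpq hmk (hsq.trans_eq (by ring))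

end Overlap

/-! ### Mixed moments of centred edge indicators -/

section EdgeMoment

variable {α V : Type*} [DecidableEq α] [DecidableEq V] {m : ℕ → ℕ → ℝ} {q ρ : ℝ}

/-- The properties of the mixed moments `m a b = 𝔼[X ^ a * Y ^ b]` of a pair of centred edge
indicators of variance `q` and correlation `ρ` that the second moment method needs. -/
structure IsCentredMoment (m : ℕ → ℕ → ℝ) (q ρ : ℝ) : Prop where
  zero_zero : m 0 0 = 1
  one_zero : m 1 0 = 0
  zero_one : m 0 1 = 0
  two_zero : m 2 0 = q
  zero_two : m 0 2 = q
  one_one : m 1 1 = ρ * q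
  mem_Icc : ∀ ⦃a b⦄, a ≤ 2 → b ≤ 2 → 0 < a + b → m a b ∈ Set.Icc 0 q

/-- The number of the two sets `A`, `B` that contain `e`. -/
def multiplicity (A B : Finset α) (e : α) : ℕ := (if e ∈ A then 1 else 0) + if e ∈ B then 1 else 0

lemma multiplicity_le_two (A B : Finset α) (e : α) : multiplicity A B e ≤ 2 := by
  unfold multiplicity
  split_ifs <;> norm_num

/-- The contribution of the coincidences in pairs among four sets of edges to their mixed moment,
relative to `q ^ k`, where `2 * k` is the total number of edges. -/
def pairing (ρ : ℝ) (k : ℕ) (E : Fin 4 → Finset α) : ℝ :=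
  ρ ^ k * ((if E 0 = E 2 then 1 else 0) * if E 1 = E 3 then 1 else 0)
    + ρ ^ k * ((if E 0 = E 3 then 1 else 0) * if E 2 = E 1 then 1 else 0)
    + (if E 0 = E 1 then 1 else 0) * if E 2 = E 3 then 1 else 0

lemma pairing_nonneg (hρ : 0 ≤ ρ) (k : ℕ) (E : Fin 4 → Finset α) : 0 ≤ pairing ρ k E := by
  unfold pairing
  positivity

lemma pairing_vec (ρ : ℝ) (k : ℕ) (A B C D : Finset α) :
    pairing ρ k ![A, B, C, D] = ρ ^ k * ((if A = C then 1 else 0) * if B = D then 1 else 0)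
      + ρ ^ k * ((if A = D then 1 else 0) * if C = B then 1 else 0)
      + (if A = B then 1 else 0) * if C = D then 1 else 0 :=
  rfl

lemma pow_le_pairing_straight (hρ : 0 ≤ ρ) (k : ℕ) (A B : Finset α) :
    ρ ^ k ≤ pairing ρ k ![A, B, A, B] := by
  simp only [pairing_vec, if_true, mul_one, add_assoc]
  exact le_add_of_nonneg_right (by positivity)

lemma pow_le_pairing_crossed (hρ : 0 ≤ ρ) (k : ℕ) (A B : Finset α) :
    ρ ^ k ≤ pairing ρ k ![A, B, B, A] := by
  simp only [pairing_vec, if_true, mul_one, add_comm _ (ρ ^ k), add_assoc]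
  exact le_add_of_nonneg_right (by positivity)

lemma one_le_pairing_parallel (hρ : 0 ≤ ρ) (k : ℕ) (A B : Finset α) :
    1 ≤ pairing ρ k ![A, A, B, B] := by
  simp only [pairing_vec, if_true, mul_one]
  exact le_add_of_nonneg_left (by positivity)

variable [Fintype α]

lemma prod_mul_prod_eq_prod_pow_multiplicity (A B : Finset α) (f : α → ℝ) :
    (∏ e ∈ A, f e) * ∏ e ∈ B, f e = ∏ e, f e ^ multiplicity A B e := by
  simp only [multiplicity, pow_add, Finset.prod_mul_distrib, pow_ite, pow_one, pow_zero,
    Finset.prod_ite_mem, Finset.univ_inter]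

/-- The expectation of the product of the centred indicators over four sets of edges, of which
`E 0` and `E 1` refer to the first graph and `E 2` and `E 3` to the second, when `m` gives the mixed
moments at a single edge. -/
noncomputable def edgeMoment (m : ℕ → ℕ → ℝ) (E : Fin 4 → Finset α) : ℝ :=
  ∏ e, m (multiplicity (E 0) (E 1) e) (multiplicity (E 2) (E 3) e)

lemma coveredTwice_of_edgeMoment_ne_zero (hm : IsCentredMoment m q ρ) {E : Fin 4 → Finset α}
    (h : edgeMoment m E ≠ 0) : CoveredTwice E := by
  intro i e he
  have hfactor := Finset.prod_ne_zero_iff.1 h e (Finset.mem_univ e)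
  by_contra! hne
  have hne0 := hne 0
  have hne1 := hne 1
  have hne2 := hne 2
  have hne3 := hne 3
  fin_cases i <;> simp_all [multiplicity, hm.one_zero, hm.zero_one]

lemma edgeMoment_le_pow_card_biUnion (hm : IsCentredMoment m q ρ) (E : Fin 4 → Finset α) :
    edgeMoment m E ≤ q ^ (Finset.univ.biUnion E).card := by
  have hfactor : ∀ e, m (multiplicity (E 0) (E 1) e) (multiplicity (E 2) (E 3) e)
      ∈ Set.Icc 0 (if e ∈ Finset.univ.biUnion E then q else 1) := by
    intro e
    have hmem : e ∈ Finset.univ.biUnion E ↔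
        0 < multiplicity (E 0) (E 1) e + multiplicity (E 2) (E 3) e := by
      simp only [Finset.mem_biUnion, Finset.mem_univ, true_and, Fin.exists_fin_succ, multiplicity]
      grind
    split_ifs with he
    · exact hm.mem_Icc (multiplicity_le_two ..) (multiplicity_le_two ..) (hmem.1 he)
    · have hsum := Nat.eq_zero_of_not_pos (mt hmem.2 he)
      rw [Nat.eq_zero_of_add_eq_zero_right hsum, Nat.eq_zero_of_add_eq_zero_left hsum,
        hm.zero_zero]
      exact ⟨zero_le_one, le_rfl⟩
  refine (Finset.prod_le_prod (fun e _ => (hfactor e).1) fun e _ => (hfactor e).2).trans_eq ?_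
  rw [Finset.prod_ite_mem, Finset.univ_inter, Finset.prod_const]

lemma edgeMoment_of_empty_of_empty (hm : IsCentredMoment m q ρ) (A B : Finset α) :
    edgeMoment m ![A, ∅, B, ∅] = if A = B then (ρ * q) ^ A.card else 0 := by
  split_ifs with hAB
  · subst hAB
    rw [← Finset.prod_const, ← Finset.univ_inter A, ← Finset.prod_ite_mem]
    refine Finset.prod_congr rfl fun e _ => ?_
    by_cases he : e ∈ A <;> simp [multiplicity, he, hm.one_one, hm.zero_zero]
  · by_contra hne
    have hcov := coveredTwice_of_edgeMoment_ne_zero hm hne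
    refine hAB (Finset.Subset.antisymm (fun e he => ?_) fun e he => ?_)
    · simpa [Fin.exists_fin_succ] using hcov 0 e he
    · simpa [Fin.exists_fin_succ] using hcov 2 e he

lemma prod_ite_mem_union {A B : Finset α} (h : Disjoint A B) (c : ℝ) :
    ∏ e, (if e ∈ A ∪ B then c else 1) = c ^ (A.card + B.card) := by
  rw [Finset.prod_ite_mem, Finset.univ_inter, Finset.prod_const, Finset.card_union_of_disjoint h]

lemma edgeMoment_straight (hm : IsCentredMoment m q ρ) {A B : Finset α} (h : Disjoint A B) :
    edgeMoment m ![A, B, A, B] = (ρ * q) ^ (A.card + B.card) := by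
  rw [← prod_ite_mem_union h]
  refine Finset.prod_congr rfl fun e _ => ?_
  have hnot : e ∈ A → e ∉ B := fun he => Finset.disjoint_left.1 h he
  by_cases hA : e ∈ A <;> by_cases hB : e ∈ B <;>
    simp_all [multiplicity, hm.one_one, hm.zero_zero]

lemma edgeMoment_crossed (hm : IsCentredMoment m q ρ) {A B : Finset α} (h : Disjoint A B) :
    edgeMoment m ![A, B, B, A] = (ρ * q) ^ (A.card + B.card) := by
  rw [← edgeMoment_straight hm h]
  refine Finset.prod_congr rfl fun e _ => congrArg (m _) (add_comm _ _)

lemma edgeMoment_parallel (hm : IsCentredMoment m q ρ) {A B : Finset α} (h : Disjoint A B) :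
    edgeMoment m ![A, A, B, B] = q ^ (A.card + B.card) := by
  rw [← prod_ite_mem_union h]
  refine Finset.prod_congr rfl fun e _ => ?_
  have hnot : e ∈ A → e ∉ B := fun he => Finset.disjoint_left.1 h he
  by_cases hA : e ∈ A <;> by_cases hB : e ∈ B <;>
    simp_all [multiplicity, hm.two_zero, hm.zero_two, hm.zero_zero]

variable [Fintype V] {E : Fin 4 → Finset (Sym2 V)} {k : ℕ}

lemma edgeMoment_le_pairing (hm : IsCentredMoment m q ρ) (hq : 0 ≤ q) (hρ : 0 ≤ ρ)
    (hconn : ∀ i, IsConnectedEdgeSet (E i)) (hcov : CoveredTwice E)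
    (hpt : NoTriplePoint fun i => verts (E i)) (hk : ∑ i, (E i).card = 2 * k) :
    edgeMoment m E ≤ q ^ k * pairing ρ k E := by
  have hqk : 0 ≤ q ^ k := pow_nonneg hq k
  rw [Fin.sum_univ_four] at hk
  have eq_vec (A B C D : Finset (Sym2 V)) (h0 : E 0 = A) (h1 : E 1 = B) (h2 : E 2 = C)
      (h3 : E 3 = D) : E = ![A, B, C, D] := by
    ext i : 1
    fin_cases i <;> assumption
  rcases eq_in_pairs_of_exists_ne_eq (exists_ne_eq hconn hcov hpt) with
    ⟨h02, h13⟩ | ⟨h03, h12⟩ | ⟨h01, h23⟩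
  · have hdisj := disjoint_of_eq hpt (k := 1) (by decide) (by decide) (by decide) h02
    have hcard : (E 0).card + (E 1).card = k := by rw [← h02, ← h13] at hk; omega
    rw [eq_vec _ _ _ _ rfl rfl h02.symm h13.symm, edgeMoment_straight hm hdisj, hcard, mul_pow,
      mul_comm]
    gcongr
    exact pow_le_pairing_straight hρ ..
  · have hdisj := disjoint_of_eq hpt (k := 1) (by decide) (by decide) (by decide) h03
    have hcard : (E 0).card + (E 1).card = k := by rw [← h03, ← h12] at hk; omega
    rw [eq_vec _ _ _ _ rfl rfl h12.symm h03.symm, edgeMoment_crossed hm hdisj, hcard, mul_pow,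
      mul_comm]
    gcongr
    exact pow_le_pairing_crossed hρ ..
  · have hdisj := disjoint_of_eq hpt (k := 2) (by decide) (by decide) (by decide) h01
    have hcard : (E 0).card + (E 2).card = k := by rw [← h01, ← h23] at hk; omega
    rw [eq_vec _ _ _ _ rfl h01.symm rfl h23.symm, edgeMoment_parallel hm hdisj, hcard]
    exact le_mul_of_one_le_right hqk (one_le_pairing_parallel hρ ..)

lemma edgeMoment_le {x p ε : ℝ} {v : ℕ} (hm : IsCentredMoment m q ρ) (hρ : 0 ≤ ρ) (hx : 1 ≤ x)
    (hp : 0 < p) (hpq : p ≤ 2 * q) (hε : 0 ≤ ε) (hconn : ∀ i, IsConnectedEdgeSet (E i))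
    (hdense : ∀ i, IsDense x p ε (E i)) (hv : ∑ i, (verts (E i)).card = 2 * v)
    (hk : ∑ i, (E i).card = 2 * k) :
    edgeMoment m E ≤ q ^ k * (pairing ρ k E
      + 2 ^ k * x ^ (-ε / 2) * x ^ v * x⁻¹ ^ (verts (Finset.univ.biUnion E)).card) := by
  have hq : 0 ≤ q := by linarith
  have hpairing : 0 ≤ q ^ k * pairing ρ k E := mul_nonneg (by positivity) (pairing_nonneg hρ k E)
  have hoverlap : 0 ≤ 2 ^ k * x ^ (-ε / 2) * x ^ v * x⁻¹ ^ (verts (Finset.univ.biUnion E)).card :=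
    by positivity
  by_cases hzero : edgeMoment m E = 0
  · rw [hzero, mul_add]
    positivity
  have hcov := coveredTwice_of_edgeMoment_ne_zero hm hzero
  by_cases hpt : NoTriplePoint fun i => verts (E i)
  · refine (edgeMoment_le_pairing hm hq hρ hconn hcov hpt hk).trans ?_
    gcongr
    exact le_add_of_nonneg_right hoverlap
  · calc edgeMoment m E ≤ q ^ (Finset.univ.biUnion E).card := edgeMoment_le_pow_card_biUnion hm E
      _ ≤ 2 ^ k * x ^ (-ε / 2) * x ^ v * q ^ k * x⁻¹ ^ (verts (Finset.univ.biUnion E)).card :=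
        pow_card_biUnion_le hx hp hpq hε hcov hdense hpt hv hk
      _ ≤ _ := by linarith

end EdgeMoment

/-! ### Copies of a motif -/

section Copies

variable {V : Type*} {M N : Motif}

/-- The edges of the copy of `M` along the embedding `f`. -/
noncomputable def copyEdges (M : Motif) (f : Fin M.v ↪ V) : Finset (Sym2 V) :=
  M.graph.edgeSet.toFinite.toFinset.map f.sym2Map

/-- Every nonempty subgraph `M'` of `M` satisfies `x ^ v(M') * p ^ e(M') ≥ x ^ ε`, where `x` stands
for the number of vertices of the random graph. -/
def Motif.HasDenseSubgraphs (x p ε : ℝ) (M : Motif) : Prop :=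
  ∀ M' : M.graph.Subgraph, M'.verts.Nonempty → x ^ ε ≤ x ^ M'.verts.ncard * p ^ M'.edgeSet.ncard

lemma homWeight_eq_prod_copyEdges (M : Motif) (β : Sym2 V → ℝ) (f : Fin M.v ↪ V) :
    homWeight M β f = ∏ e ∈ copyEdges M f, β e := by
  rw [copyEdges, Finset.prod_map]
  rfl

lemma card_copyEdges (M : Motif) (f : Fin M.v ↪ V) : (copyEdges M f).card = M.e := by
  rw [copyEdges, Finset.card_map, Motif.e, Set.ncard_eq_toFinset_card _ (Set.toFinite _)]

lemma mem_copyEdges {f : Fin M.v ↪ V} {e : Sym2 V} :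
    e ∈ copyEdges M f ↔ ∃ a b, M.graph.Adj a b ∧ s(f a, f b) = e := by
  simp only [copyEdges, Finset.mem_map, Set.Finite.mem_toFinset, Sym2.exists,
    SimpleGraph.mem_edgeSet, Function.Embedding.sym2Map_apply, Sym2.map_mk]

lemma mk_mem_copyEdges {f : Fin M.v ↪ V} {a b : Fin M.v} :
    s(f a, f b) ∈ copyEdges M f ↔ M.graph.Adj a b := by
  rw [← Sym2.map_mk, ← f.sym2Map_apply, copyEdges, Finset.mem_map', Set.Finite.mem_toFinset,
    SimpleGraph.mem_edgeSet]

lemma not_isDiag_of_mem_copyEdges {f : Fin M.v ↪ V} {e : Sym2 V} (he : e ∈ copyEdges M f) :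
    ¬ e.IsDiag := by
  obtain ⟨a, b, h, rfl⟩ := mem_copyEdges.1 he
  simpa only [Sym2.mk_isDiag_iff, f.apply_eq_iff_eq] using h.ne

lemma Motif.exists_adj (hc : M.graph.Connected) (he : M.e ≠ 0) (a : Fin M.v) :
    ∃ b, M.graph.Adj a b := by
  obtain ⟨⟨c, d⟩, hcd⟩ := Set.nonempty_of_ncard_ne_zero he
  have : Nontrivial (Fin M.v) := ⟨c, d, SimpleGraph.Adj.ne hcd⟩
  exact hc.preconnected.exists_adj_of_nontrivial a

section Connected

variable [DecidableEq V]

lemma verts_copyEdges (hc : M.graph.Connected) (he : M.e ≠ 0) (f : Fin M.v ↪ V) :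
    verts (copyEdges M f) = Finset.univ.map f := by
  ext u
  simp only [mem_verts, Finset.mem_map, Finset.mem_univ, true_and]
  constructor
  · rintro ⟨w, hw⟩
    obtain ⟨a, b, -, hab⟩ := mem_copyEdges.1 hw
    obtain ⟨rfl, -⟩ | ⟨-, rfl⟩ := Sym2.eq_iff.1 hab
    exacts [⟨a, rfl⟩, ⟨b, rfl⟩]
  · rintro ⟨a, rfl⟩
    obtain ⟨b, hb⟩ := Motif.exists_adj hc he a
    exact ⟨f b, mk_mem_copyEdges.2 hb⟩

lemma card_verts_copyEdges (hc : M.graph.Connected) (he : M.e ≠ 0) (f : Fin M.v ↪ V) :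
    (verts (copyEdges M f)).card = M.v := by
  rw [verts_copyEdges hc he, Finset.card_map, Finset.card_univ, Fintype.card_fin]

lemma isConnectedEdgeSet_copyEdges (hc : M.graph.Connected) (he : M.e ≠ 0) (f : Fin M.v ↪ V) :
    IsConnectedEdgeSet (copyEdges M f) where
  nonempty := Finset.card_ne_zero.1 (card_copyEdges M f ▸ he)
  reachable := by
    let φ : M.graph →g SimpleGraph.fromEdgeSet (copyEdges M f : Set (Sym2 V)) :=
      { toFun := f
        map_rel' := fun h =>
          (SimpleGraph.fromEdgeSet_adj _).2 ⟨mk_mem_copyEdges.2 h, f.injective.ne h.ne⟩ }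
    simp only [verts_copyEdges hc he, Finset.forall_mem_map]
    exact fun a _ b _ => (hc.preconnected a b).map φ

lemma isDense_copyEdges {x p ε : ℝ} (hsub : M.HasDenseSubgraphs x p ε) (hc : M.graph.Connected)
    (he : M.e ≠ 0) (f : Fin M.v ↪ V) : IsDense x p ε (copyEdges M f) := by
  intro E hE W hW hne hEW
  rw [verts_copyEdges hc he] at hW
  let M' : M.graph.Subgraph :=
    { verts := f ⁻¹' W
      Adj := fun a b => s(f a, f b) ∈ E
      adj_sub := fun h => mk_mem_copyEdges.1 (hE h)
      edge_vert := fun h => hEW (left_mem_verts h)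
      symm := ⟨fun a b h => Sym2.eq_swap ▸ h⟩ }
  have hverts : f '' M'.verts = W :=
    Set.image_preimage_eq_of_subset fun u hu => by
      obtain ⟨a, -, rfl⟩ := Finset.mem_map.1 (hW hu)
      exact ⟨a, rfl⟩
  have hedges : f.sym2Map '' M'.edgeSet = E := by
    refine Set.Subset.antisymm ?_ fun e he => ?_
    · rintro _ ⟨⟨a, b⟩, hab, rfl⟩
      exact hab
    · obtain ⟨a, b, -, rfl⟩ := mem_copyEdges.1 (hE he)
      exact ⟨s(a, b), he, rfl⟩
  have hcardVerts : M'.verts.ncard = W.card := by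
    rw [← Set.ncard_image_of_injective _ f.injective, hverts, Set.ncard_coe_finset]
  have hcardEdges : M'.edgeSet.ncard = E.card := by
    rw [← Set.ncard_image_of_injective _ f.sym2Map.injective, hedges, Set.ncard_coe_finset]
  have hne' : M'.verts.Nonempty := by
    rwa [← Set.image_nonempty (f := f), hverts, Finset.coe_nonempty]
  exact hcardVerts ▸ hcardEdges ▸ hsub M' hne'

lemma verts_biUnion_copyEdges (hM : M.graph.Connected) (hMe : M.e ≠ 0) (hN : N.graph.Connected)
    (hNe : N.e ≠ 0) (f₁ g₁ : Fin M.v ↪ V) (f₂ g₂ : Fin N.v ↪ V) :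
    verts (Finset.univ.biUnion ![copyEdges M f₁, copyEdges N f₂, copyEdges M g₁, copyEdges N g₂])
      = Finset.univ.image (Sum.elim (Sum.elim f₁ f₂) (Sum.elim g₁ g₂)) := by
  ext u
  simp only [verts_biUnion, Finset.mem_biUnion, Finset.mem_univ, true_and, Fin.exists_fin_succ,
    Matrix.cons_val_zero, Matrix.cons_val_succ, verts_copyEdges hM hMe, verts_copyEdges hN hNe,
    Finset.mem_map, Finset.mem_image, Sum.exists, Sum.elim_inl, Sum.elim_inr, or_assoc,
    IsEmpty.exists_iff, or_false]

end Connected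

lemma exists_iso_of_copyEdges_eq (hM : M.graph.Connected) (hMe : M.e ≠ 0)
    (hN : N.graph.Connected) (hNe : N.e ≠ 0) {f : Fin M.v ↪ V} {g : Fin N.v ↪ V}
    (h : copyEdges M f = copyEdges N g) : ∃ σ : M.graph ≃g N.graph, ∀ a, g (σ a) = f a := by
  classical
  have hmap := congrArg verts h
  rw [verts_copyEdges hM hMe, verts_copyEdges hN hNe] at hmap
  have hrange : Set.range f = Set.range g := by
    simpa only [Finset.coe_map, Finset.coe_univ, Set.image_univ]
      using congrArg (fun s : Finset V => (s : Set V)) hmap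
  let e : Fin M.v ≃ Fin N.v := (Equiv.ofInjective f f.injective).trans
    ((Equiv.setCongr hrange).trans (Equiv.ofInjective g g.injective).symm)
  have he : ∀ a, g (e a) = f a := fun a =>
    congrArg Subtype.val ((Equiv.ofInjective g g.injective).apply_symm_apply
      (Equiv.setCongr hrange (Equiv.ofInjective f f.injective a)))
  refine ⟨⟨e, fun {a b} => ?_⟩, he⟩
  rw [← mk_mem_copyEdges (f := g), he, he, ← h, mk_mem_copyEdges]

lemma copyEdges_comp_iso (f : Fin M.v ↪ V) (σ : M.graph ≃g M.graph) :
    copyEdges M (σ.toEquiv.toEmbedding.trans f) = copyEdges M f := by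
  ext e
  simp only [mem_copyEdges]
  constructor
  · rintro ⟨a, b, h, rfl⟩
    exact ⟨σ a, σ b, σ.map_adj_iff.2 h, rfl⟩
  · rintro ⟨a, b, h, rfl⟩
    exact ⟨σ.symm a, σ.symm b, σ.symm.map_adj_iff.2 h, by simp⟩

instance (M : Motif) : Finite (M.graph ≃g M.graph) :=
  Finite.of_injective _ RelIso.toEquiv_injective

lemma Motif.aut_pos (M : Motif) : 0 < M.aut :=
  Nat.card_pos_iff.2 ⟨⟨SimpleGraph.Iso.refl⟩, inferInstance⟩

variable [Fintype V] [DecidableEq V]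

lemma injCount_congr {β β' : Sym2 V → ℝ} (h : ∀ e, ¬ e.IsDiag → β e = β' e) :
    injCount M β = injCount M β' := by
  simp only [injCount, homWeight_eq_prod_copyEdges]
  exact Finset.sum_congr rfl fun f _ =>
    Finset.prod_congr rfl fun e he => h e (not_isDiag_of_mem_copyEdges he)

lemma injCount_comp_perm (M : Motif) (β : Sym2 V → ℝ) (π : Equiv.Perm V) :
    injCount M (fun e => β (e.map π)) = injCount M β :=
  Fintype.sum_equiv (Equiv.embeddingCongr (Equiv.refl _) π) _ _ fun _ =>
    Finset.prod_congr rfl fun _ _ => congrArg β (Sym2.map_map ..)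

end Copies

/-! ### Counting copies -/

section Counting

variable {ι V : Type*} [Fintype ι] [DecidableEq ι] [Fintype V] [DecidableEq V] {r : ℝ}

lemma sum_pow_card_insert_le (hr : 0 ≤ r) (hrV : Fintype.card V * r ≤ 1) (W : Finset V) :
    ∑ a, r ^ (insert a W).card ≤ (W.card + 1) * r ^ W.card := by
  have hle : ∀ a, r ^ (insert a W).card ≤ (if a ∈ W then r ^ W.card else 0) + r * r ^ W.card := by
    intro a
    by_cases ha : a ∈ W
    · rw [Finset.insert_eq_of_mem ha, if_pos ha]
      exact le_add_of_nonneg_right (by positivity)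
    · rw [Finset.card_insert_of_notMem ha, if_neg ha, pow_succ, zero_add, mul_comm]
  refine (Finset.sum_le_sum fun a _ => hle a).trans ?_
  rw [Finset.sum_add_distrib, Finset.sum_ite_mem, Finset.univ_inter, Finset.sum_const,
    Finset.sum_const, Finset.card_univ, nsmul_eq_mul, nsmul_eq_mul, ← mul_assoc, add_mul]
  gcongr

/-- A point added to an image of `k` points hits it for at most `k` of its values, and otherwise
the factor `r` pays for the sum over its values. -/
lemma sum_pow_card_image_le_factorial (hr : 0 ≤ r) (hrV : Fintype.card V * r ≤ 1) :
    ∑ f : ι → V, r ^ (Finset.univ.image f).card ≤ (Fintype.card ι).factorial := by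
  revert ‹DecidableEq ι›
  refine Fintype.induction_empty_option (P := fun ι _ => ∀ [DecidableEq ι],
    ∑ f : ι → V, r ^ (Finset.univ.image f).card ≤ (Fintype.card ι).factorial) ?_ ?_ ?_ ι
  · intro α β _ e ih _
    classical
    have := Fintype.ofEquiv β e.symm
    rw [← Fintype.card_congr e, ← (e.arrowCongr (Equiv.refl V)).sum_comp]
    convert ih using 5 with f
    ext u
    simp [e.symm.exists_congr_left]
  · intro _
    simp
  · intro α _ ih _
    classical
    have himage (a : V) (g : α → V) :
        Finset.univ.image ((Equiv.piOptionEquivProd (β := fun _ => V)).symm (a, g))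
          = insert a (Finset.univ.image g) := by
      ext u
      simp [Equiv.piOptionEquivProd, Option.exists, eq_comm]
    rw [← Equiv.piOptionEquivProd.symm.sum_comp, Fintype.sum_prod_type_right]
    simp only [himage]
    calc ∑ g : α → V, ∑ a, r ^ (insert a (Finset.univ.image g)).card
        ≤ ∑ g : α → V, ((Fintype.card α : ℝ) + 1) * r ^ (Finset.univ.image g).card := by
          refine Finset.sum_le_sum fun g _ => (sum_pow_card_insert_le hr hrV _).trans ?_
          gcongr
          exact Finset.card_image_le
      _ ≤ ((Fintype.card α : ℝ) + 1) * (Fintype.card α).factorial := by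
          rw [← Finset.mul_sum]
          gcongr
          exact ih
      _ = (Fintype.card (Option α)).factorial := by
          rw [Fintype.card_option, Nat.factorial_succ]
          push_cast
          ring

lemma sum_comp_le_sum_of_injective {α β : Type*} [Fintype α] [Fintype β] {φ : α → β}
    (hφ : Function.Injective φ) {F : β → ℝ} (hF : ∀ b, 0 ≤ F b) : ∑ a, F (φ a) ≤ ∑ b, F b :=
  (Finset.sum_map Finset.univ ⟨φ, hφ⟩ F).symm.trans_le (Finset.sum_le_univ_sum_of_nonneg hF)

variable {M N : Motif}

lemma sum_pow_card_verts_biUnion_copyEdges_le (hM : M.graph.Connected) (hMe : M.e ≠ 0)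
    (hN : N.graph.Connected) (hNe : N.e ≠ 0) (hr : 0 ≤ r) (hrV : Fintype.card V * r ≤ 1) :
    ∑ f₁ : Fin M.v ↪ V, ∑ f₂ : Fin N.v ↪ V, ∑ g₁ : Fin M.v ↪ V, ∑ g₂ : Fin N.v ↪ V,
      r ^ (verts (Finset.univ.biUnion
        ![copyEdges M f₁, copyEdges N f₂, copyEdges M g₁, copyEdges N g₂])).card
      ≤ (2 * (M.v + N.v)).factorial := by
  simp only [verts_biUnion_copyEdges hM hMe hN hNe]
  let φ (x : (Fin M.v ↪ V) × (Fin N.v ↪ V) × (Fin M.v ↪ V) × (Fin N.v ↪ V)) :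
      (Fin M.v ⊕ Fin N.v) ⊕ (Fin M.v ⊕ Fin N.v) → V :=
    Sum.elim (Sum.elim x.1 x.2.1) (Sum.elim x.2.2.1 x.2.2.2)
  have hφ : Function.Injective φ := by
    rintro ⟨f₁, f₂, g₁, g₂⟩ ⟨f₁', f₂', g₁', g₂'⟩ h
    simpa [φ, Sum.elim_eq_iff, and_assoc] using h
  calc _ = ∑ x, r ^ (Finset.univ.image (φ x)).card := by simp only [Fintype.sum_prod_type, φ]
    _ ≤ ∑ f, r ^ (Finset.univ.image f).card :=
        sum_comp_le_sum_of_injective hφ (F := fun f => r ^ (Finset.univ.image f).card)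
          fun _ => by positivity
    _ ≤ (Fintype.card ((Fin M.v ⊕ Fin N.v) ⊕ (Fin M.v ⊕ Fin N.v))).factorial :=
        sum_pow_card_image_le_factorial hr hrV
    _ = _ := by simp only [Fintype.card_sum, Fintype.card_fin, two_mul]

/-- The number of pairs of copies of `M` and of `N` in the complete graph on `V` that have the same
edges. It is a real number, as it only occurs in estimates of moments. -/
noncomputable def coincidences (V : Type*) [Fintype V] [DecidableEq V] (M N : Motif) : ℝ :=
  ∑ f : Fin M.v ↪ V, ∑ g : Fin N.v ↪ V, if copyEdges M f = copyEdges N g then 1 else 0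

lemma aut_le_card_copyEdges_eq (f : Fin M.v ↪ V) :
    M.aut ≤ (Finset.univ.filter fun g : Fin M.v ↪ V => copyEdges M f = copyEdges M g).card := by
  have := Fintype.ofFinite (M.graph ≃g M.graph)
  rw [Motif.aut, Nat.card_eq_fintype_card, ← Finset.card_univ]
  refine Finset.card_le_card_of_injOn (fun σ => σ.toEquiv.toEmbedding.trans f) (fun σ _ => ?_)
    fun σ _ σ' _ h => ?_
  · simp only [Finset.coe_filter, Finset.mem_univ, true_and, Set.mem_ofPred_eq,
      copyEdges_comp_iso]
  · exact DFunLike.ext _ _ fun a => f.injective (DFunLike.congr_fun h a)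

lemma card_copyEdges_eq_le_aut (hM : M.graph.Connected) (hMe : M.e ≠ 0) (f : Fin M.v ↪ V) :
    (Finset.univ.filter fun g : Fin M.v ↪ V => copyEdges M f = copyEdges M g).card ≤ M.aut := by
  have := Fintype.ofFinite (M.graph ≃g M.graph)
  rw [Motif.aut, Nat.card_eq_fintype_card, ← Finset.card_univ]
  refine Finset.card_le_card_of_surjOn (fun σ => σ.toEquiv.toEmbedding.trans f) fun g hg => ?_
  simp only [Finset.coe_filter, Finset.mem_univ, true_and, Set.mem_ofPred_eq] at hg
  obtain ⟨σ, hσ⟩ := exists_iso_of_copyEdges_eq hM hMe hM hMe hg.symm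
  exact ⟨σ, by simp, DFunLike.ext _ _ hσ⟩

lemma descFactorial_mul_aut_le_coincidences :
    ((Fintype.card V).descFactorial M.v : ℝ) * M.aut ≤ coincidences V M M := by
  calc ((Fintype.card V).descFactorial M.v : ℝ) * M.aut = ∑ _f : Fin M.v ↪ V, (M.aut : ℝ) := by
        simp [Fintype.card_embedding_eq]
    _ ≤ _ := Finset.sum_le_sum fun f _ => by
        rw [Finset.sum_boole]
        exact_mod_cast aut_le_card_copyEdges_eq f

lemma coincidences_self (hM : M.graph.Connected) (hMe : M.e ≠ 0) :
    coincidences V M M = (Fintype.card V).descFactorial M.v * M.aut := by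
  refine le_antisymm ?_ descFactorial_mul_aut_le_coincidences
  calc coincidences V M M ≤ ∑ _f : Fin M.v ↪ V, (M.aut : ℝ) := Finset.sum_le_sum fun f _ => by
        rw [Finset.sum_boole]
        exact_mod_cast card_copyEdges_eq_le_aut hM hMe f
    _ = _ := by simp [Fintype.card_embedding_eq]

lemma coincidences_eq_zero (hM : M.graph.Connected) (hMe : M.e ≠ 0) (hN : N.graph.Connected)
    (hNe : N.e ≠ 0) (hMN : ¬ Nonempty (M.graph ≃g N.graph)) : coincidences V M N = 0 :=
  Finset.sum_eq_zero fun _ _ => Finset.sum_eq_zero fun _ _ => if_neg fun h =>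
    hMN (exists_iso_of_copyEdges_eq hM hMe hN hNe h).nonempty

lemma sum_pairing_copyEdges (ρ : ℝ) (k : ℕ) (M N : Motif) :
    ∑ f₁ : Fin M.v ↪ V, ∑ f₂ : Fin N.v ↪ V, ∑ g₁ : Fin M.v ↪ V, ∑ g₂ : Fin N.v ↪ V,
      pairing ρ k ![copyEdges M f₁, copyEdges N f₂, copyEdges M g₁, copyEdges N g₂]
      = ρ ^ k * (coincidences V M M * coincidences V N N)
        + (ρ ^ k + 1) * coincidences V M N ^ 2 := by
  simp only [pairing_vec, Finset.sum_add_distrib, ← Finset.mul_sum, ← Finset.sum_mul]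
  have hswap : ∑ f₂ : Fin N.v ↪ V, ∑ g₁ : Fin M.v ↪ V,
      (if copyEdges M g₁ = copyEdges N f₂ then (1 : ℝ) else 0) = coincidences V M N :=
    Finset.sum_comm
  rw [hswap]
  unfold coincidences
  ring

end Counting

/-! ### Correlated bits -/

section Bits

variable {p ρ : ℝ}

/-- The centred indicator of an edge whose presence is encoded by the bit `b`. -/
def bitVal (p : ℝ) (b : Bool) : ℝ := (if b then 1 else 0) - p

lemma integral_corrBernoulli (hp0 : 0 ≤ p) (hp1 : p ≤ 1) (hρ0 : 0 ≤ ρ) (hρ1 : ρ ≤ 1)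
    (g : Bool × Bool → ℝ) :
    ∫ z, g z ∂corrBernoulli p ρ = (p ^ 2 + ρ * (p * (1 - p))) * g (true, true)
      + ((1 - ρ) * (p * (1 - p))) * g (true, false) + ((1 - ρ) * (p * (1 - p))) * g (false, true)
      + ((1 - p) ^ 2 + ρ * (p * (1 - p))) * g (false, false) := by
  have hq : 0 ≤ p * (1 - p) := mul_nonneg hp0 (by linarith)
  have hdiff : 0 ≤ (1 - ρ) * (p * (1 - p)) := mul_nonneg (by linarith) hq
  have hint (a : ℝ) (z : Bool × Bool) : Integrable g (ENNReal.ofReal a • Measure.dirac z) :=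
    (integrable_dirac (by simp)).smul_measure ENNReal.ofReal_ne_top
  rw [corrBernoulli, integral_add_measure (((hint ..).add_measure (hint ..)).add_measure (hint ..))
    (hint ..), integral_add_measure ((hint ..).add_measure (hint ..)) (hint ..),
    integral_add_measure (hint ..) (hint ..)]
  simp only [integral_smul_measure, integral_dirac, smul_eq_mul, ENNReal.toReal_ofReal hdiff,
    ENNReal.toReal_ofReal (show 0 ≤ p ^ 2 + ρ * (p * (1 - p)) by positivity),
    ENNReal.toReal_ofReal (show 0 ≤ (1 - p) ^ 2 + ρ * (p * (1 - p)) by positivity)]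

lemma isProbabilityMeasure_corrBernoulli (hp0 : 0 ≤ p) (hp1 : p ≤ 1) (hρ0 : 0 ≤ ρ) (hρ1 : ρ ≤ 1) :
    IsProbabilityMeasure (corrBernoulli p ρ) := by
  have hone := integral_corrBernoulli hp0 hp1 hρ0 hρ1 fun _ => 1
  rw [integral_const, smul_eq_mul, mul_one] at hone
  rw [isProbabilityMeasure_iff_real, hone]
  ring

/-- The mixed moments of a pair of centred correlated bits. -/
noncomputable def bitMoment (p ρ : ℝ) (a b : ℕ) : ℝ :=
  ∫ z, bitVal p z.1 ^ a * bitVal p z.2 ^ b ∂corrBernoulli p ρ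

lemma bitMoment_eq (hp0 : 0 ≤ p) (hp1 : p ≤ 1) (hρ0 : 0 ≤ ρ) (hρ1 : ρ ≤ 1) (a b : ℕ) :
    bitMoment p ρ a b = (p ^ 2 + ρ * (p * (1 - p))) * ((1 - p) ^ a * (1 - p) ^ b)
      + ((1 - ρ) * (p * (1 - p))) * ((1 - p) ^ a * (-p) ^ b)
      + ((1 - ρ) * (p * (1 - p))) * ((-p) ^ a * (1 - p) ^ b)
      + ((1 - p) ^ 2 + ρ * (p * (1 - p))) * ((-p) ^ a * (-p) ^ b) := by
  rw [bitMoment, integral_corrBernoulli hp0 hp1 hρ0 hρ1]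
  simp [bitVal]

lemma isCentredMoment_bitMoment (hp0 : 0 ≤ p) (hp : p ≤ 1 / 2) (hρ0 : 0 ≤ ρ) (hρ1 : ρ ≤ 1) :
    IsCentredMoment (bitMoment p ρ) (p * (1 - p)) ρ := by
  have heq := bitMoment_eq hp0 (by linarith) hρ0 hρ1
  have hq : 0 ≤ p * (1 - p) := mul_nonneg hp0 (by linarith)
  have hskew : 0 ≤ 1 - 2 * p := by linarith
  have mem_Icc_mul {t : ℝ} (ht0 : 0 ≤ t) (ht1 : t ≤ 1) :
      t * (p * (1 - p)) ∈ Set.Icc 0 (p * (1 - p)) :=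
    ⟨mul_nonneg ht0 hq, mul_le_of_le_one_left hq ht1⟩
  have h00 : bitMoment p ρ 0 0 = 1 := by rw [heq]; ring
  have h10 : bitMoment p ρ 1 0 = 0 := by rw [heq]; ring
  have h01 : bitMoment p ρ 0 1 = 0 := by rw [heq]; ring
  have h20 : bitMoment p ρ 2 0 = p * (1 - p) := by rw [heq]; ring
  have h02 : bitMoment p ρ 0 2 = p * (1 - p) := by rw [heq]; ring
  have h11 : bitMoment p ρ 1 1 = ρ * (p * (1 - p)) := by rw [heq]; ring
  have h21 : bitMoment p ρ 2 1 = (1 - 2 * p) * ρ * (p * (1 - p)) := by rw [heq]; ring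
  have h12 : bitMoment p ρ 1 2 = (1 - 2 * p) * ρ * (p * (1 - p)) := by rw [heq]; ring
  have h22 : bitMoment p ρ 2 2 = (p * (1 - p) + (1 - 2 * p) ^ 2 * ρ) * (p * (1 - p)) := by
    rw [heq]; ring
  refine ⟨h00, h10, h01, h20, h02, h11, fun a b ha hb hab => ?_⟩
  interval_cases a <;> interval_cases b
  · exact absurd hab (lt_irrefl 0)
  · rw [h01]; exact ⟨le_rfl, hq⟩
  · rw [h02]; exact ⟨hq, le_rfl⟩
  · rw [h10]; exact ⟨le_rfl, hq⟩
  · rw [h11]; exact mem_Icc_mul hρ0 hρ1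
  · rw [h12]; exact mem_Icc_mul (by positivity) (mul_le_one₀ (by linarith) hρ0 hρ1)
  · rw [h20]; exact ⟨hq, le_rfl⟩
  · rw [h21]; exact mem_Icc_mul (by positivity) (mul_le_one₀ (by linarith) hρ0 hρ1)
  · rw [h22]
    refine mem_Icc_mul (by positivity) ?_
    have : (1 - 2 * p) ^ 2 * ρ ≤ (1 - 2 * p) ^ 2 := mul_le_of_le_one_right (sq_nonneg _) hρ1
    nlinarith

/-- The law of a family of independent pairs of correlated bits. -/
noncomputable def bitLaw (ι : Type*) [Fintype ι] (p ρ : ℝ) : Measure (ι → Bool × Bool) :=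
  Measure.pi fun _ => corrBernoulli p ρ

lemma isProbabilityMeasure_bitLaw (ι : Type*) [Fintype ι] (hp0 : 0 ≤ p) (hp1 : p ≤ 1)
    (hρ0 : 0 ≤ ρ) (hρ1 : ρ ≤ 1) : IsProbabilityMeasure (bitLaw ι p ρ) := by
  have := isProbabilityMeasure_corrBernoulli hp0 hp1 hρ0 hρ1
  rw [bitLaw]
  infer_instance

lemma integral_bitLaw_prod {ι : Type*} [Fintype ι] [DecidableEq ι] (hp0 : 0 ≤ p) (hp1 : p ≤ 1)
    (hρ0 : 0 ≤ ρ) (hρ1 : ρ ≤ 1) (A₁ A₂ B₁ B₂ : Finset ι) :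
    ∫ x, (∏ e ∈ A₁, bitVal p (x e).1) * (∏ e ∈ A₂, bitVal p (x e).1) *
      ((∏ e ∈ B₁, bitVal p (x e).2) * ∏ e ∈ B₂, bitVal p (x e).2) ∂bitLaw ι p ρ
      = edgeMoment (bitMoment p ρ) ![A₁, A₂, B₁, B₂] := by
  have := isProbabilityMeasure_corrBernoulli hp0 hp1 hρ0 hρ1
  simp only [prod_mul_prod_eq_prod_pow_multiplicity, ← Finset.prod_mul_distrib]
  exact integral_fintype_prod_eq_prod (μ := fun _ : ι => corrBernoulli p ρ) fun e z =>
    bitVal p z.1 ^ multiplicity A₁ A₂ e * bitVal p z.2 ^ multiplicity B₁ B₂ e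

end Bits

/-! ### Undoing the latent bijection -/

section Transport

variable {n : ℕ} {p ρ : ℝ}

/-- The product `inj(M, Ḡ₁) inj(M, Ḡ₂)` for the pair of graphs with edge indicators `x`, when the
latent bijection is the identity. -/
noncomputable def pairedCount {V : Type*} [Fintype V] [DecidableEq V] (p : ℝ) (M : Motif)
    (x : Sym2 V → Bool × Bool) : ℝ :=
  injCount M (fun e => bitVal p (x e).1) * injCount M fun e => bitVal p (x e).2

/-- The motif counting statistic as a function of the edge indicators. -/
noncomputable def bitStatistic (n : ℕ) (p ρ : ℝ) (𝓜 : Finset Motif)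
    (x : Sym2 (Fin n) → Bool × Bool) : ℝ :=
  ∑ M ∈ 𝓜, weight n p ρ M * pairedCount p M x

lemma injCount_centered_fromEdgeSet {V : Type*} [Fintype V] [DecidableEq V] (M : Motif)
    (b : Sym2 V → Bool) :
    injCount M (centered p (SimpleGraph.fromEdgeSet {e | b e = true}))
      = injCount M fun e => bitVal p (b e) := by
  refine injCount_congr fun e he => ?_
  simp only [centered, bitVal, SimpleGraph.edgeSet_fromEdgeSet, Set.mem_sdiff,
    Set.mem_ofPred_eq, Sym2.mem_diagSet, he, not_false_eq_true, and_true]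

lemma statistic_graphPair (𝓜 : Finset Motif) (π : Equiv.Perm (Fin n))
    (x : Sym2 (Fin n) → Bool × Bool) :
    statistic n p ρ 𝓜 (graphPair π x) = bitStatistic n p ρ 𝓜 x := by
  refine Finset.sum_congr rfl fun M _ => ?_
  rw [graphPair, injCount_centered_fromEdgeSet M fun e => (x e).1,
    injCount_centered_fromEdgeSet M fun e => (x (e.map π.symm)).2,
    injCount_comp_perm M (fun e => bitVal p (x e).2) π.symm, mul_assoc, pairedCount]

instance {V : Type*} [Countable V] : MeasurableSingletonClass (SimpleGraph V) := by
  refine ⟨fun G => ⟨{G.Adj}, measurableSet_singleton _, ?_⟩⟩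
  ext H
  exact SimpleGraph.adj_inj

lemma identDistrib_statistic_bitStatistic (n : ℕ) (p ρ : ℝ) (𝓜 : Finset Motif) :
    IdentDistrib (statistic n p ρ 𝓜) (bitStatistic n p ρ 𝓜) (corrER n p ρ)
      (bitLaw (Sym2 (Fin n)) p ρ) := by
  have hstat : Measurable (statistic n p ρ 𝓜) := measurable_of_countable _
  refine ⟨hstat.aemeasurable, (measurable_of_countable _).aemeasurable, ?_⟩
  have hgiven (π : Equiv.Perm (Fin n)) : (corrERGiven n p ρ π).map (statistic n p ρ 𝓜)
      = (bitLaw (Sym2 (Fin n)) p ρ).map (bitStatistic n p ρ 𝓜) := by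
    rw [corrERGiven, Measure.map_map hstat (measurable_of_countable _)]
    exact congrArg (Measure.map · _) (funext (statistic_graphPair 𝓜 π))
  rw [corrER, Measure.map_smul, Measure.map_finset_sum hstat.aemeasurable]
  simp only [hgiven, Finset.sum_const, Finset.card_univ, Fintype.card_perm, Fintype.card_fin]
  rw [← Nat.cast_smul_eq_nsmul ℝ≥0∞, smul_smul, ENNReal.inv_mul_cancel, one_smul]
  · exact_mod_cast Nat.factorial_ne_zero n
  · exact ENNReal.natCast_ne_top _

end Transport

/-! ### Covariances of the paired counts -/

section Covariance

variable {V : Type*} [Fintype V] [DecidableEq V] {p ρ ε : ℝ} {M N : Motif}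

lemma integral_fintype_sum {ι Ω : Type*} [Fintype ι] [MeasurableSpace Ω] [Finite Ω]
    [MeasurableSingletonClass Ω] {μ : Measure Ω} [IsFiniteMeasure μ] (F : ι → Ω → ℝ) :
    ∫ x, ∑ i, F i x ∂μ = ∑ i, ∫ x, F i x ∂μ :=
  integral_finsetSum _ fun _ _ => Integrable.of_finite

lemma sum_mul_sum_mul_sum_mul_sum {ι κ : Type*} [Fintype ι] [Fintype κ] (a c : ι → ℝ)
    (b d : κ → ℝ) : (∑ i, a i) * (∑ j, b j) * ((∑ i, c i) * ∑ j, d j)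
      = ∑ i, ∑ j, ∑ k, ∑ l, a i * b j * (c k * d l) := by
  rw [Finset.sum_mul_sum, Finset.sum_mul_sum]
  simp only [Finset.sum_mul]
  simp only [Finset.mul_sum]

lemma integral_pairedCount (hp0 : 0 ≤ p) (hp : p ≤ 1 / 2) (hρ0 : 0 ≤ ρ) (hρ1 : ρ ≤ 1) (M : Motif) :
    ∫ x, pairedCount p M x ∂bitLaw (Sym2 V) p ρ
      = (ρ * (p * (1 - p))) ^ M.e * coincidences V M M := by
  have := isProbabilityMeasure_bitLaw (Sym2 V) hp0 (by linarith) hρ0 hρ1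
  have hterm (f g : Fin M.v ↪ V) : ∫ x, (∏ e ∈ copyEdges M f, bitVal p (x e).1) *
      ∏ e ∈ copyEdges M g, bitVal p (x e).2 ∂bitLaw (Sym2 V) p ρ
      = (ρ * (p * (1 - p))) ^ M.e * if copyEdges M f = copyEdges M g then 1 else 0 := by
    have h := integral_bitLaw_prod hp0 (by linarith) hρ0 hρ1 (copyEdges M f) ∅ (copyEdges M g) ∅
    simp only [Finset.prod_empty, mul_one] at h
    rw [h, edgeMoment_of_empty_of_empty (isCentredMoment_bitMoment hp0 hp hρ0 hρ1), card_copyEdges,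
      mul_ite, mul_one, mul_zero]
  simp only [pairedCount, injCount, homWeight_eq_prod_copyEdges, Finset.sum_mul_sum,
    integral_fintype_sum, hterm]
  simp only [coincidences, Finset.mul_sum]

lemma integral_pairedCount_mul_pairedCount (hp0 : 0 ≤ p) (hp1 : p ≤ 1) (hρ0 : 0 ≤ ρ) (hρ1 : ρ ≤ 1)
    (M N : Motif) :
    ∫ x, pairedCount p M x * pairedCount p N x ∂bitLaw (Sym2 V) p ρ
      = ∑ f₁ : Fin M.v ↪ V, ∑ f₂ : Fin N.v ↪ V, ∑ g₁ : Fin M.v ↪ V, ∑ g₂ : Fin N.v ↪ V,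
        edgeMoment (bitMoment p ρ)
          ![copyEdges M f₁, copyEdges N f₂, copyEdges M g₁, copyEdges N g₂] := by
  have := isProbabilityMeasure_bitLaw (Sym2 V) hp0 hp1 hρ0 hρ1
  simp only [pairedCount, mul_mul_mul_comm, injCount, homWeight_eq_prod_copyEdges,
    sum_mul_sum_mul_sum_mul_sum, integral_fintype_sum, integral_bitLaw_prod hp0 hp1 hρ0 hρ1]

lemma edgeMoment_copyEdges_le [Nonempty V] (hp0 : 0 < p) (hp : p ≤ 1 / 2) (hρ0 : 0 ≤ ρ)
    (hρ1 : ρ ≤ 1) (hε : 0 ≤ ε) (hM : M.graph.Connected) (hMe : M.e ≠ 0)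
    (hMsub : M.HasDenseSubgraphs (Fintype.card V) p ε)
    (hN : N.graph.Connected) (hNe : N.e ≠ 0)
    (hNsub : N.HasDenseSubgraphs (Fintype.card V) p ε)
    (f₁ g₁ : Fin M.v ↪ V) (f₂ g₂ : Fin N.v ↪ V) :
    edgeMoment (bitMoment p ρ) ![copyEdges M f₁, copyEdges N f₂, copyEdges M g₁, copyEdges N g₂]
      ≤ (p * (1 - p)) ^ (M.e + N.e) *
        (pairing ρ (M.e + N.e) ![copyEdges M f₁, copyEdges N f₂, copyEdges M g₁, copyEdges N g₂]
          + 2 ^ (M.e + N.e) * (Fintype.card V : ℝ) ^ (-ε / 2)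
            * (Fintype.card V : ℝ) ^ (M.v + N.v)
            * (Fintype.card V : ℝ)⁻¹ ^ (verts (Finset.univ.biUnion
                ![copyEdges M f₁, copyEdges N f₂, copyEdges M g₁, copyEdges N g₂])).card) := by
  refine edgeMoment_le (isCentredMoment_bitMoment hp0.le hp hρ0 hρ1) hρ0
    (by exact_mod_cast Fintype.card_pos) hp0 (by nlinarith) hε ?_ ?_ ?_ ?_
  · have hconnM := isConnectedEdgeSet_copyEdges hM hMe (V := V)
    have hconnN := isConnectedEdgeSet_copyEdges hN hNe (V := V)
    intro i
    fin_cases i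
    exacts [hconnM f₁, hconnN f₂, hconnM g₁, hconnN g₂]
  · have hdenseM := isDense_copyEdges hMsub hM hMe (V := V)
    have hdenseN := isDense_copyEdges hNsub hN hNe (V := V)
    intro i
    fin_cases i
    exacts [hdenseM f₁, hdenseN f₂, hdenseM g₁, hdenseN g₂]
  · refine (Fin.sum_univ_four _).trans ?_
    simp only [Matrix.cons_val, card_verts_copyEdges hM hMe, card_verts_copyEdges hN hNe]
    ring
  · refine (Fin.sum_univ_four _).trans ?_
    simp only [Matrix.cons_val, card_copyEdges]
    ring

lemma covariance_pairedCount_le [Nonempty V] (hp0 : 0 < p) (hp : p ≤ 1 / 2) (hρ0 : 0 ≤ ρ)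
    (hρ1 : ρ ≤ 1) (hε : 0 ≤ ε) (hM : M.graph.Connected) (hMe : M.e ≠ 0)
    (hMsub : M.HasDenseSubgraphs (Fintype.card V) p ε)
    (hN : N.graph.Connected) (hNe : N.e ≠ 0)
    (hNsub : N.HasDenseSubgraphs (Fintype.card V) p ε) :
    cov[pairedCount p M, pairedCount p N; bitLaw (Sym2 V) p ρ] ≤
      (p * (1 - p)) ^ (M.e + N.e) * ((ρ ^ (M.e + N.e) + 1) * coincidences V M N ^ 2
        + 2 ^ (M.e + N.e) * (Fintype.card V : ℝ) ^ (-ε / 2) * (Fintype.card V : ℝ) ^ (M.v + N.v)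
          * (2 * (M.v + N.v)).factorial) := by
  have := isProbabilityMeasure_bitLaw (Sym2 V) hp0.le (by linarith) hρ0 hρ1
  have hq : 0 ≤ p * (1 - p) := mul_nonneg hp0.le (by linarith)
  have hx : (0 : ℝ) < Fintype.card V := by exact_mod_cast Fintype.card_pos
  have hcount := sum_pow_card_verts_biUnion_copyEdges_le hM hMe hN hNe (V := V)
    (inv_nonneg.2 hx.le) (mul_inv_cancel₀ hx.ne').le
  have hmixed : ∫ x, pairedCount p M x * pairedCount p N x ∂bitLaw (Sym2 V) p ρ ≤
      (p * (1 - p)) ^ (M.e + N.e) *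
        (ρ ^ (M.e + N.e) * (coincidences V M M * coincidences V N N)
          + (ρ ^ (M.e + N.e) + 1) * coincidences V M N ^ 2
        + 2 ^ (M.e + N.e) * (Fintype.card V : ℝ) ^ (-ε / 2) * (Fintype.card V : ℝ) ^ (M.v + N.v)
          * (2 * (M.v + N.v)).factorial) := by
    rw [integral_pairedCount_mul_pairedCount hp0.le (by linarith) hρ0 hρ1]
    refine (Finset.sum_le_sum fun f₁ _ => Finset.sum_le_sum fun f₂ _ => Finset.sum_le_sum
      fun g₁ _ => Finset.sum_le_sum fun g₂ _ => edgeMoment_copyEdges_le hp0 hp hρ0 hρ1 hε hM hMe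
        hMsub hN hNe hNsub f₁ g₁ f₂ g₂).trans ?_
    simp only [← Finset.mul_sum, Finset.sum_add_distrib, sum_pairing_copyEdges]
    gcongr
  rw [covariance_eq_sub MemLp.of_discrete MemLp.of_discrete]
  simp only [Pi.mul_apply]
  rw [integral_pairedCount hp0.le hp hρ0 hρ1, integral_pairedCount hp0.le hp hρ0 hρ1, mul_pow ρ,
    mul_pow ρ]
  linear_combination hmixed

end Covariance

/-! ### The second moment method -/

section SecondMoment

variable {n : ℕ} {p ρ C ε₀ : ℝ} {M N : Motif} {𝓜 : Finset Motif}

/-- The conditions that `C`-admissibility of a family puts on each of its members. -/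
structure Motif.IsAdmissible (n : ℕ) (p C ε₀ : ℝ) (M : Motif) : Prop where
  connected : M.graph.Connected
  v_le : (M.v : ℝ) ≤ C
  e_le : (M.e : ℝ) ≤ C
  hasDenseSubgraphs : M.HasDenseSubgraphs n p ε₀

lemma Motif.IsAdmissible.one_le (h : M.IsAdmissible n p C ε₀) : 1 ≤ C := by
  obtain ⟨a⟩ := h.connected.nonempty
  have hv : (1 : ℝ) ≤ M.v := by exact_mod_cast a.pos
  exact hv.trans h.v_le

lemma Motif.IsAdmissible.two_mul_v_le (h : M.IsAdmissible n p C ε₀) (hC : 2 * C ≤ n) :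
    2 * M.v ≤ n := by
  have hv := h.v_le
  have : (2 * M.v : ℝ) ≤ n := by linarith
  exact_mod_cast this

lemma Motif.IsAdmissible.rpow_le (h : M.IsAdmissible n p C ε₀) : (n : ℝ) ^ ε₀ ≤ n := by
  obtain ⟨a⟩ := h.connected.nonempty
  simpa using h.hasDenseSubgraphs (M.graph.singletonSubgraph a) (Set.singleton_nonempty a)

lemma weight_nonneg (hp0 : 0 ≤ p) (hp1 : p ≤ 1) (hρ0 : 0 ≤ ρ) : 0 ≤ weight n p ρ M := by
  have : 0 ≤ p * (1 - p) := mul_nonneg hp0 (by linarith)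
  unfold weight
  positivity

lemma weight_mul_descFactorial_mul_aut (hp0 : 0 < p) (hp1 : p < 1) (hv : M.v ≤ n) :
    weight n p ρ M * ((n.descFactorial M.v : ℝ) * M.aut) * (p * (1 - p)) ^ M.e = ρ ^ M.e := by
  have : 0 < p * (1 - p) := mul_pos hp0 (by linarith)
  have haut : (M.aut : ℝ) ≠ 0 := by exact_mod_cast M.aut_pos.ne'
  have hfac : ((n - M.v).factorial : ℝ) * n.descFactorial M.v = n.factorial := by
    exact_mod_cast Nat.factorial_mul_descFactorial hv
  rw [weight, div_mul_eq_mul_div, div_mul_eq_mul_div, div_eq_iff (by positivity), ← hfac]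
  ring

lemma pow_le_two_pow_mul_descFactorial {v : ℕ} (hv : 2 * v ≤ n) :
    n ^ v ≤ 2 ^ v * n.descFactorial v :=
  calc n ^ v ≤ (2 * (n + 1 - v)) ^ v := Nat.pow_le_pow_left (by omega) v
    _ = 2 ^ v * (n + 1 - v) ^ v := mul_pow _ _ _
    _ ≤ 2 ^ v * n.descFactorial v := Nat.mul_le_mul_left _ (Nat.pow_sub_le_descFactorial n v)

lemma weight_mul_pow_le (hp0 : 0 < p) (hp1 : p < 1) (hρ0 : 0 ≤ ρ) (hv : 2 * M.v ≤ n) :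
    weight n p ρ M * (n : ℝ) ^ M.v * (p * (1 - p)) ^ M.e ≤ 2 ^ M.v * ρ ^ M.e := by
  have : 0 < p * (1 - p) := mul_pos hp0 (by linarith)
  have hw : 0 ≤ weight n p ρ M := weight_nonneg hp0.le hp1.le hρ0
  have haut : (1 : ℝ) ≤ M.aut := by exact_mod_cast M.aut_pos
  have hpow : (n : ℝ) ^ M.v ≤ 2 ^ M.v * (n.descFactorial M.v * M.aut) :=
    calc (n : ℝ) ^ M.v ≤ 2 ^ M.v * n.descFactorial M.v := by
          exact_mod_cast pow_le_two_pow_mul_descFactorial hv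
      _ ≤ 2 ^ M.v * (n.descFactorial M.v * M.aut) := by
          gcongr
          exact le_mul_of_one_le_right (by positivity) haut
  calc weight n p ρ M * (n : ℝ) ^ M.v * (p * (1 - p)) ^ M.e
      ≤ weight n p ρ M * (2 ^ M.v * (n.descFactorial M.v * M.aut)) * (p * (1 - p)) ^ M.e := by
        gcongr
    _ = 2 ^ M.v * ρ ^ M.e := by
        rw [← weight_mul_descFactorial_mul_aut (n := n) (ρ := ρ) hp0 hp1 (by omega)]
        ring

lemma signalScore_pos (hρ0 : 0 < ρ) (hne : 𝓜.Nonempty) : 0 < signalScore ρ 𝓜 :=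
  Finset.sum_pos (fun _ _ => pow_pos hρ0 _) hne

lemma signalScore_le_integral_bitStatistic (hp0 : 0 < p) (hp : p ≤ 1 / 2) (hρ0 : 0 ≤ ρ)
    (hρ1 : ρ ≤ 1) (hv : ∀ M ∈ 𝓜, M.v ≤ n) :
    signalScore ρ 𝓜 ≤ ∫ x, bitStatistic n p ρ 𝓜 x ∂bitLaw (Sym2 (Fin n)) p ρ := by
  have := isProbabilityMeasure_bitLaw (Sym2 (Fin n)) hp0.le (by linarith) hρ0 hρ1
  have hq : 0 < p * (1 - p) := mul_pos hp0 (by linarith)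
  simp only [bitStatistic]
  rw [integral_finsetSum _ fun _ _ => Integrable.of_finite]
  refine Finset.sum_le_sum fun M hM => ?_
  have hw : 0 ≤ weight n p ρ M := weight_nonneg hp0.le (by linarith) hρ0
  have hcoinc := descFactorial_mul_aut_le_coincidences (V := Fin n) (M := M)
  rw [Fintype.card_fin] at hcoinc
  rw [integral_const_mul, integral_pairedCount hp0.le hp hρ0 hρ1]
  calc ρ ^ (2 * M.e) = weight n p ρ M *
        ((ρ * (p * (1 - p))) ^ M.e * ((n.descFactorial M.v : ℝ) * M.aut)) := by
        rw [two_mul, pow_add, mul_pow]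
        nth_rw 1 [← weight_mul_descFactorial_mul_aut (ρ := ρ) hp0 (by linarith) (hv M hM)]
        ring
    _ ≤ weight n p ρ M * ((ρ * (p * (1 - p))) ^ M.e * coincidences (Fin n) M M) := by gcongr

/-- The contribution to the relative variance of the quadruples of copies with a vertex in three of
them. -/
noncomputable def overlapError (n : ℕ) (ρ C ε₀ : ℝ) : ℝ :=
  (n : ℝ) ^ (-ε₀ / 2) * (4 * C) ^ (8 * C) * ρ ^ (-2 * C)

lemma two_pow_mul_factorial_le (hC : 1 ≤ C) {a b c d : ℕ} (ha : a ≤ C) (hb : b ≤ C) (hc : c ≤ C)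
    (hd : d ≤ C) :
    (2 : ℝ) ^ (a + b) * 2 ^ (c + d) * (2 * (c + d)).factorial ≤ (4 * C) ^ (8 * C) := by
  have h2 : (2 : ℝ) ≤ 4 * C := by linarith
  have hcd : ((2 * (c + d) : ℕ) : ℝ) ≤ 4 * C := by push_cast; linarith
  have hfac : ((2 * (c + d)).factorial : ℝ) ≤ ((2 * (c + d) : ℕ) : ℝ) ^ (2 * (c + d)) := by
    exact_mod_cast Nat.factorial_le_pow _
  calc (2 : ℝ) ^ (a + b) * 2 ^ (c + d) * (2 * (c + d)).factorial
      ≤ (4 * C) ^ (a + b) * (4 * C) ^ (c + d) * (4 * C) ^ (2 * (c + d)) := by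
        refine mul_le_mul (by gcongr) (hfac.trans ?_) (by positivity) (by positivity)
        gcongr
    _ = (4 * C) ^ ((a + b + (c + d) + 2 * (c + d) : ℕ) : ℝ) := by
        rw [Real.rpow_natCast]; ring
    _ ≤ (4 * C) ^ (8 * C) := by
        refine Real.rpow_le_rpow_of_exponent_le (by linarith) ?_
        push_cast
        linarith

lemma pow_le_rpow_mul_pow (hρ0 : 0 < ρ) (hρ1 : ρ ≤ 1) {a b : ℕ} (ha : a ≤ C) (hb : b ≤ C) :
    ρ ^ (a + b) ≤ ρ ^ (-2 * C) * (ρ ^ (2 * a) * ρ ^ (2 * b)) := by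
  rw [← pow_add, ← Real.rpow_natCast, ← Real.rpow_natCast, ← Real.rpow_add hρ0]
  refine Real.rpow_le_rpow_of_exponent_ge hρ0 hρ1 ?_
  push_cast
  linarith

lemma weight_mul_weight_mul_overlap_le (hp0 : 0 < p) (hp1 : p < 1) (hρ0 : 0 < ρ) (hρ1 : ρ ≤ 1)
    (hCn : 2 * C ≤ n) (hM : M.IsAdmissible n p C ε₀) (hN : N.IsAdmissible n p C ε₀) :
    weight n p ρ M * weight n p ρ N * ((p * (1 - p)) ^ (M.e + N.e) * (2 ^ (M.e + N.e)
        * (n : ℝ) ^ (-ε₀ / 2) * (n : ℝ) ^ (M.v + N.v) * (2 * (M.v + N.v)).factorial))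
      ≤ overlapError n ρ C ε₀ * (ρ ^ (2 * M.e) * ρ ^ (2 * N.e)) := by
  have : 0 < p * (1 - p) := mul_pos hp0 (by linarith)
  have hw (K : Motif) : 0 ≤ weight n p ρ K := weight_nonneg hp0.le hp1.le hρ0.le
  have hC := hM.one_le
  set D : ℝ := (Nat.factorial (2 * (M.v + N.v)) : ℝ)
  have hwM := weight_mul_pow_le hp0 hp1 hρ0.le (hM.two_mul_v_le hCn)
  have hwN := weight_mul_pow_le hp0 hp1 hρ0.le (hN.two_mul_v_le hCn)
  have hweights := mul_le_mul hwM hwN (mul_nonneg (mul_nonneg (hw N) (by positivity))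
    (by positivity)) (by positivity)
  calc _ = (n : ℝ) ^ (-ε₀ / 2) * (2 ^ (M.e + N.e) * D) *
        ((weight n p ρ M * (n : ℝ) ^ M.v * (p * (1 - p)) ^ M.e) *
        (weight n p ρ N * (n : ℝ) ^ N.v * (p * (1 - p)) ^ N.e)) := by ring
    _ ≤ (n : ℝ) ^ (-ε₀ / 2) * (2 ^ (M.e + N.e) * D) *
        ((2 ^ M.v * ρ ^ M.e) * (2 ^ N.v * ρ ^ N.e)) := by gcongr
    _ = (n : ℝ) ^ (-ε₀ / 2) * (2 ^ (M.e + N.e) * 2 ^ (M.v + N.v) * D) * ρ ^ (M.e + N.e) := by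
        ring
    _ ≤ (n : ℝ) ^ (-ε₀ / 2) * (4 * C) ^ (8 * C) *
        (ρ ^ (-2 * C) * (ρ ^ (2 * M.e) * ρ ^ (2 * N.e))) := by
        gcongr
        · exact two_pow_mul_factorial_le hC hM.e_le hN.e_le hM.v_le hN.v_le
        · exact pow_le_rpow_mul_pow hρ0 hρ1 hM.e_le hN.e_le
    _ = _ := by rw [overlapError]; ring

lemma weight_mul_coincidences_self (hp0 : 0 < p) (hp1 : p < 1) (hM : M.graph.Connected)
    (hMe : M.e ≠ 0) (hv : M.v ≤ n) :
    weight n p ρ M * coincidences (Fin n) M M * (p * (1 - p)) ^ M.e = ρ ^ M.e := by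
  rw [coincidences_self hM hMe, Fintype.card_fin, weight_mul_descFactorial_mul_aut hp0 hp1 hv]

lemma weight_mul_weight_mul_coincidences_sq_le (hp0 : 0 < p) (hp1 : p < 1) (hρ0 : 0 ≤ ρ)
    (hρ1 : ρ ≤ 1) (hM : M.graph.Connected) (hMe : M.e ≠ 0) (hv : M.v ≤ n) (hN : N.graph.Connected)
    (hNe : N.e ≠ 0) (hMN : Nonempty (M.graph ≃g N.graph) → M = N) [Decidable (M = N)] :
    weight n p ρ M * weight n p ρ N * ((p * (1 - p)) ^ (M.e + N.e)
      * ((ρ ^ (M.e + N.e) + 1) * coincidences (Fin n) M N ^ 2))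
      ≤ if M = N then 2 * ρ ^ (2 * M.e) else 0 := by
  split_ifs with h
  · subst h
    calc _ = (ρ ^ (M.e + M.e) + 1) *
          (weight n p ρ M * coincidences (Fin n) M M * (p * (1 - p)) ^ M.e) ^ 2 := by ring
      _ = (ρ ^ (M.e + M.e) + 1) * ρ ^ (2 * M.e) := by
          rw [weight_mul_coincidences_self hp0 hp1 hM hMe hv, ← pow_mul, mul_comm M.e]
      _ ≤ 2 * ρ ^ (2 * M.e) := by
          gcongr
          linarith [pow_le_one₀ (n := M.e + M.e) hρ0 hρ1]
  · rw [coincidences_eq_zero hM hMe hN hNe (mt hMN h)]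
    simp

lemma pairedCount_of_e_eq_zero {V : Type*} [Fintype V] [DecidableEq V] (hMe : M.e = 0)
    (x : Sym2 V → Bool × Bool) :
    pairedCount p M x = (Fintype.card (Fin M.v ↪ V) : ℝ) * Fintype.card (Fin M.v ↪ V) := by
  have hcopy (f : Fin M.v ↪ V) : copyEdges M f = ∅ := by
    rw [← Finset.card_eq_zero, card_copyEdges, hMe]
  simp only [pairedCount, injCount, homWeight_eq_prod_copyEdges, hcopy, Finset.prod_empty,
    Finset.sum_const, Finset.card_univ, nsmul_eq_mul, mul_one]

lemma weight_mul_weight_mul_covariance_le (hn : 0 < n) (hp0 : 0 < p) (hp : p ≤ 1 / 2)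
    (hρ0 : 0 < ρ) (hρ1 : ρ ≤ 1) (hε : 0 ≤ ε₀) (hCn : 2 * C ≤ n) (hM : M.IsAdmissible n p C ε₀)
    (hN : N.IsAdmissible n p C ε₀) (hMN : Nonempty (M.graph ≃g N.graph) → M = N)
    [Decidable (M = N)] :
    weight n p ρ M * weight n p ρ N *
        cov[pairedCount p M, pairedCount p N; bitLaw (Sym2 (Fin n)) p ρ]
      ≤ (if M = N then 2 * ρ ^ (2 * M.e) else 0)
        + overlapError n ρ C ε₀ * (ρ ^ (2 * M.e) * ρ ^ (2 * N.e)) := by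
  have := isProbabilityMeasure_bitLaw (Sym2 (Fin n)) hp0.le (by linarith) hρ0.le hρ1
  have : Nonempty (Fin n) := ⟨⟨0, hn⟩⟩
  have hC := hM.one_le
  have hbound : 0 ≤ (if M = N then 2 * ρ ^ (2 * M.e) else 0)
      + overlapError n ρ C ε₀ * (ρ ^ (2 * M.e) * ρ ^ (2 * N.e)) := by
    unfold overlapError
    split_ifs <;> positivity
  by_cases hMe : M.e = 0
  · rwa [funext (pairedCount_of_e_eq_zero hMe), covariance_const_left, mul_zero]
  by_cases hNe : N.e = 0
  · rwa [funext (pairedCount_of_e_eq_zero hNe), covariance_const_right, mul_zero]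
  have hwM : 0 ≤ weight n p ρ M := weight_nonneg hp0.le (by linarith) hρ0.le
  have hwN : 0 ≤ weight n p ρ N := weight_nonneg hp0.le (by linarith) hρ0.le
  have hcov := covariance_pairedCount_le (V := Fin n) hp0 hp hρ0.le hρ1 hε hM.connected hMe
    (by simpa using hM.hasDenseSubgraphs) hN.connected hNe (by simpa using hN.hasDenseSubgraphs)
  rw [Fintype.card_fin, mul_add] at hcov
  refine (mul_le_mul_of_nonneg_left hcov (mul_nonneg hwM hwN)).trans ?_
  rw [mul_add]
  refine add_le_add ?_ ?_
  · have hv : M.v ≤ n := by have := hM.two_mul_v_le hCn; omega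
    exact weight_mul_weight_mul_coincidences_sq_le hp0 (by linarith) hρ0.le hρ1 hM.connected hMe hv
      hN.connected hNe hMN
  · exact weight_mul_weight_mul_overlap_le hp0 (by linarith) hρ0 hρ1 hCn hM hN

lemma variance_bitStatistic_le (hn : 0 < n) (hp0 : 0 < p) (hp : p ≤ 1 / 2) (hρ0 : 0 < ρ)
    (hρ1 : ρ ≤ 1) (hε : 0 ≤ ε₀) (hCn : 2 * C ≤ n) (hfam : IsMotifFamily 𝓜)
    (hadm : ∀ M ∈ 𝓜, M.IsAdmissible n p C ε₀) :
    Var[bitStatistic n p ρ 𝓜; bitLaw (Sym2 (Fin n)) p ρ]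
      ≤ 2 * signalScore ρ 𝓜 + overlapError n ρ C ε₀ * signalScore ρ 𝓜 ^ 2 := by
  classical
  have := isProbabilityMeasure_bitLaw (Sym2 (Fin n)) hp0.le (by linarith) hρ0.le hρ1
  have hdiag : ∑ M ∈ 𝓜, ∑ N ∈ 𝓜, (if M = N then 2 * ρ ^ (2 * M.e) else 0)
      = 2 * signalScore ρ 𝓜 := by
    rw [signalScore, Finset.mul_sum]
    exact Finset.sum_congr rfl fun M hM => by rw [Finset.sum_ite_eq, if_pos hM]
  calc Var[bitStatistic n p ρ 𝓜; bitLaw (Sym2 (Fin n)) p ρ]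
      = ∑ M ∈ 𝓜, ∑ N ∈ 𝓜, weight n p ρ M * weight n p ρ N *
        cov[pairedCount p M, pairedCount p N; bitLaw (Sym2 (Fin n)) p ρ] := by
        rw [← covariance_self (measurable_of_countable _).aemeasurable]
        unfold bitStatistic
        rw [covariance_fun_sum_fun_sum' (fun _ _ => MemLp.of_discrete)
          fun _ _ => MemLp.of_discrete]
        simp only [covariance_const_mul_left, covariance_const_mul_right]
        exact Finset.sum_congr rfl fun M _ => Finset.sum_congr rfl fun N _ => by ring
    _ ≤ ∑ M ∈ 𝓜, ∑ N ∈ 𝓜, ((if M = N then 2 * ρ ^ (2 * M.e) else 0)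
        + overlapError n ρ C ε₀ * (ρ ^ (2 * M.e) * ρ ^ (2 * N.e))) :=
        Finset.sum_le_sum fun M hM => Finset.sum_le_sum fun N hN =>
          weight_mul_weight_mul_covariance_le hn hp0 hp hρ0 hρ1 hε hCn (hadm M hM) (hadm N hN)
            (hfam M hM N hN)
    _ = 2 * signalScore ρ 𝓜 + overlapError n ρ C ε₀ * signalScore ρ 𝓜 ^ 2 := by
        simp only [Finset.sum_add_distrib, hdiag, ← Finset.mul_sum, ← Finset.sum_mul, signalScore,
          sq]

lemma measureReal_lt_half_integral_le {Ω : Type*} [MeasurableSpace Ω] {μ : Measure Ω}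
    [IsFiniteMeasure μ] {X : Ω → ℝ} (hX : MemLp X 2 μ) (hpos : 0 < ∫ ω, X ω ∂μ) :
    μ.real {ω | X ω < 1 / 2 * ∫ ω, X ω ∂μ} ≤ 4 * Var[X; μ] / (∫ ω, X ω ∂μ) ^ 2 := by
  have hhalf : 0 < 1 / 2 * ∫ ω, X ω ∂μ := by positivity
  have hsubset : {ω | X ω < 1 / 2 * ∫ ω, X ω ∂μ}
      ⊆ {ω | 1 / 2 * ∫ ω, X ω ∂μ ≤ |X ω - ∫ ω, X ω ∂μ|} := fun ω hω => by
    rw [Set.mem_ofPred_eq] at hω ⊢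
    rw [abs_sub_comm]
    exact le_abs.2 (Or.inl (by linarith))
  calc μ.real {ω | X ω < 1 / 2 * ∫ ω, X ω ∂μ} ≤ Var[X; μ] / (1 / 2 * ∫ ω, X ω ∂μ) ^ 2 :=
        ENNReal.toReal_le_of_le_ofReal (div_nonneg (variance_nonneg _ _) (sq_nonneg _))
          ((measure_mono hsubset).trans (meas_ge_le_variance_div_sq hX hhalf))
    _ = 4 * Var[X; μ] / (∫ ω, X ω ∂μ) ^ 2 := by
        field_simp
        norm_num

lemma corrER_real_statistic_lt (n : ℕ) (p ρ : ℝ) (𝓜 : Finset Motif) (t : ℝ) :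
    (corrER n p ρ).real {G | statistic n p ρ 𝓜 G < t}
      = (bitLaw (Sym2 (Fin n)) p ρ).real {x | bitStatistic n p ρ 𝓜 x < t} :=
  congrArg ENNReal.toReal
    ((identDistrib_statistic_bitStatistic n p ρ 𝓜).measure_mem_eq measurableSet_Iio)

lemma two_le_overlapError (hn : 0 < n) (hρ0 : 0 < ρ) (hρ1 : ρ ≤ 1) (hε : 0 ≤ ε₀) (hC : 1 ≤ C)
    (hnε : (n : ℝ) ^ ε₀ ≤ n) (hnC : n < 2 * C) : 2 ≤ overlapError n ρ C ε₀ := by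
  have hn1 : (1 : ℝ) ≤ n := by exact_mod_cast hn
  have hn0 : (0 : ℝ) < n := by linarith
  have hρC : 1 ≤ ρ ^ (-2 * C) :=
    Real.one_le_rpow_of_pos_of_le_one_of_nonpos hρ0 hρ1 (by linarith)
  have hCC : 4 * C ≤ (4 * C) ^ (8 * C) :=
    Real.self_le_rpow_of_one_le (by linarith) (by linarith)
  have hnε' : (n : ℝ)⁻¹ ≤ (n : ℝ) ^ (-ε₀ / 2) := by
    rw [neg_div, Real.rpow_neg hn0.le]
    gcongr
    exact (Real.rpow_le_rpow_of_exponent_le hn1 (by linarith)).trans hnε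
  calc 2 ≤ (n : ℝ)⁻¹ * (4 * C) := by
        rw [inv_mul_eq_div, le_div_iff₀ hn0]
        linarith
    _ ≤ (n : ℝ) ^ (-ε₀ / 2) * (4 * C) ^ (8 * C) := by gcongr
    _ ≤ overlapError n ρ C ε₀ := le_mul_of_one_le_right (by positivity) hρC

lemma overlapError_nonneg (hρ0 : 0 ≤ ρ) (hC : 0 ≤ C) : 0 ≤ overlapError n ρ C ε₀ := by
  unfold overlapError
  positivity

lemma bitLaw_bitStatistic_lt_half_integral_le (hn : 0 < n) (hp0 : 0 < p) (hp : p ≤ 1 / 2)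
    (hρ0 : 0 < ρ) (hρ1 : ρ ≤ 1) (hε : 0 ≤ ε₀) (hCn : 2 * C ≤ n) (hne : 𝓜.Nonempty)
    (hfam : IsMotifFamily 𝓜) (hadm : ∀ M ∈ 𝓜, M.IsAdmissible n p C ε₀) :
    (bitLaw (Sym2 (Fin n)) p ρ).real {x | bitStatistic n p ρ 𝓜 x
        < 1 / 2 * ∫ x, bitStatistic n p ρ 𝓜 x ∂bitLaw (Sym2 (Fin n)) p ρ}
      ≤ 4 * (overlapError n ρ C ε₀ + 2 / signalScore ρ 𝓜) := by
  have := isProbabilityMeasure_bitLaw (Sym2 (Fin n)) hp0.le (by linarith) hρ0.le hρ1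
  have hS : 0 < signalScore ρ 𝓜 := signalScore_pos hρ0 hne
  obtain ⟨M₀, hM₀⟩ := hne
  have hv (M) (hM : M ∈ 𝓜) : M.v ≤ n := by have := (hadm M hM).two_mul_v_le hCn; omega
  have hmean := signalScore_le_integral_bitStatistic hp0 hp hρ0.le hρ1 hv
  have hvar := variance_bitStatistic_le hn hp0 hp hρ0 hρ1 hε hCn hfam hadm
  have herror : 0 ≤ overlapError n ρ C ε₀ :=
    overlapError_nonneg hρ0.le (zero_le_one.trans (hadm M₀ hM₀).one_le)
  calc _ ≤ 4 * Var[bitStatistic n p ρ 𝓜; bitLaw (Sym2 (Fin n)) p ρ]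
        / (∫ x, bitStatistic n p ρ 𝓜 x ∂bitLaw (Sym2 (Fin n)) p ρ) ^ 2 :=
        measureReal_lt_half_integral_le MemLp.of_discrete (hS.trans_le hmean)
    _ ≤ 4 * (2 * signalScore ρ 𝓜 + overlapError n ρ C ε₀ * signalScore ρ 𝓜 ^ 2)
        / signalScore ρ 𝓜 ^ 2 := by gcongr
    _ = 4 * (overlapError n ρ C ε₀ + 2 / signalScore ρ 𝓜) := by
        field_simp
        ring

lemma four_mul_error_le {L S κ : ℝ} (hL : 0 ≤ L) (hS : 1 ≤ S) (hκ : 0 ≤ κ) (h : 1 ≤ κ ∨ 2 ≤ L) :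
    4 * (L + 2 / S) ≤ 4 * (3 * L + (κ + 1) / S + κ - 1) := by
  have hS' : S⁻¹ ≤ 1 := inv_le_one_of_one_le₀ hS
  have hSpos : 0 ≤ S⁻¹ := by positivity
  simp only [div_eq_mul_inv]
  rcases h with h | h
  · nlinarith
  · nlinarith [mul_nonneg hκ hSpos]

lemma IsAdmissible.nonempty (hadm : IsAdmissible n p ρ C ε₀ 𝓜) : 𝓜.Nonempty := by
  rw [Finset.nonempty_iff_ne_empty]
  rintro rfl
  have := hadm.signal
  norm_num [signalScore] at this

lemma IsAdmissible.isAdmissible_of_mem (hadm : IsAdmissible n p ρ C ε₀ 𝓜) (hM : M ∈ 𝓜) :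
    M.IsAdmissible n p C ε₀ where
  connected := hadm.connected M hM
  v_le := (le_max_left _ _).trans (hadm.size_le M hM)
  e_le := (le_max_right _ _).trans (hadm.size_le M hM)
  hasDenseSubgraphs := hadm.subgraph M hM

lemma IsAdmissible.four_mul_error_le (hadm : IsAdmissible n p ρ C ε₀ 𝓜) (hn : 0 < n)
    (hρ0 : 0 < ρ) (hρ1 : ρ ≤ 1) :
    4 * (overlapError n ρ C ε₀ + 2 / signalScore ρ 𝓜)
      ≤ 4 * (3 * overlapError n ρ C ε₀
        + (Real.exp (C ^ 2 / ((n : ℝ) - 2 * C + 1)) + 1) / signalScore ρ 𝓜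
        + Real.exp (C ^ 2 / ((n : ℝ) - 2 * C + 1)) - 1) := by
  obtain ⟨M, hM⟩ := hadm.nonempty
  have hMadm := hadm.isAdmissible_of_mem hM
  have hC := hMadm.one_le
  have hS : 1 ≤ signalScore ρ 𝓜 := by linarith [hadm.signal]
  refine MotifCount.four_mul_error_le (overlapError_nonneg hρ0.le (by linarith)) hS
    (Real.exp_nonneg _) ?_
  rcases lt_or_ge (n : ℝ) (2 * C) with hnC | hCn
  · exact Or.inr (two_le_overlapError hn hρ0 hρ1 hadm.eps_pos.le hC hMadm.rpow_le hnC)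
  · exact Or.inl (Real.one_le_exp (div_nonneg (sq_nonneg C) (by linarith)))

end SecondMoment

end MotifCount

open MotifCount in
theorem mainTheorem2_general (n : ℕ) (hn : 0 < n) (p ρ C ε₀ : ℝ) (hp0 : 0 < p) (hp : p ≤ 1 / 2)
    (hρ0 : 0 < ρ) (hρ : ρ ≤ 1) (hε : 0 ≤ ε₀) (𝓜 : Finset Motif) (hne : 𝓜.Nonempty)
    (hfam : IsMotifFamily 𝓜) (hadm : ∀ M ∈ 𝓜, M.IsAdmissible n p C ε₀) :
    (corrER n p ρ).real
        {G | statistic n p ρ 𝓜 G < (1 / 2) * ∫ G, statistic n p ρ 𝓜 G ∂corrER n p ρ}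
      ≤ 4 * ((n : ℝ) ^ (-ε₀ / 2) * (4 * C) ^ (8 * C) * ρ ^ (-2 * C) + 2 / signalScore ρ 𝓜) := by
  have := isProbabilityMeasure_bitLaw (Sym2 (Fin n)) hp0.le (by linarith) hρ0.le hρ
  rw [corrER_real_statistic_lt, (identDistrib_statistic_bitStatistic n p ρ 𝓜).integral_eq]
  rcases lt_or_ge (n : ℝ) (2 * C) with hnC | hCn
  · have hS : 0 < signalScore ρ 𝓜 := signalScore_pos hρ0 hne
    obtain ⟨M, hM⟩ := hne
    have herror := two_le_overlapError hn hρ0 hρ hε (hadm M hM).one_le (hadm M hM).rpow_le hnC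
    rw [overlapError] at herror
    exact MeasureTheory.measureReal_le_one.trans (by linarith [div_pos two_pos hS])
  · exact bitLaw_bitStatistic_lt_half_integral_le hn hp0 hp hρ0 hρ hε hCn hne hfam hadm

theorem mainTheorem2 (n : ℕ) (hn : 0 < n) (p ρ C ε₀ : ℝ)
    (hp0 : 0 < p) (hp : p ≤ 1 / 2) (hρ0 : 0 < ρ) (hρ : ρ ≤ 1)
    (𝓜 : Finset MotifCount.Motif) (hfam : MotifCount.IsMotifFamily 𝓜)
    (hadm : MotifCount.IsAdmissible n p ρ C ε₀ 𝓜)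
    (τ : ℝ) (hτ : τ = (1 / 2) * ∫ G, MotifCount.statistic n p ρ 𝓜 G ∂MotifCount.corrER n p ρ) :
    (MotifCount.corrER n p ρ).real {G | MotifCount.statistic n p ρ 𝓜 G < τ} ≤
      4 * (3 * (n : ℝ) ^ (-ε₀ / 2) * (4 * C) ^ (8 * C) * ρ ^ (-2 * C)
        + (Real.exp (C ^ 2 / ((n : ℝ) - 2 * C + 1)) + 1) / MotifCount.signalScore ρ 𝓜
        + Real.exp (C ^ 2 / ((n : ℝ) - 2 * C + 1)) - 1) := by
  subst hτ
  refine (mainTheorem2_general n hn p ρ C ε₀ hp0 hp hρ0 hρ hadm.eps_pos.le 𝓜 hadm.nonempty hfam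
    fun M hM => hadm.isAdmissible_of_mem hM).trans ?_
  simpa only [MotifCount.overlapError, mul_assoc] using hadm.four_mul_error_le hn hρ0 hρ
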